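/- **Setting.** For $\mathbb R^d$-valued random vectors let $\psi(x)=e^{x^2}-1$, $\|X\|_\psi=\inf\{\lambda>0:\mathbb E[\psi(\|X\|/\lambda)]\le 1\}$ ($\inf\emptyset=\infty$), and for probability measures $\mu,\pi$ on $\mathbb R^d$ let $W_\psi(\mu,\pi)\in[0,\infty]$ be the infimum of $\|X-Y\|_\psi$ over all couplings $(X,Y)$ of $\mu$ and $\pi$. For real $1<q<\infty$ let $\mathsf R_q(\mu\|\pi)=\frac1{q-1}\log\mathbb E_\pi\big[(\frac{d\mu}{d\pi})^q\big]$ if $\mu\ll\pi$, and $\mathsf R_q(\mu\|\pi)=\infty$ otherwise. Given $f:\mathbb R^d\to\mathbb R$, $T>0$ and $h\ge 0$, where $T/h\in\mathbb N$ if $h>0$, let $\tilde q_{T,h}(x,v)$ be the position $x_N$ reached from $(x_0,v_0)=(x,v)$ after $N=T/h$ velocity Verlet steps $$x_{j+1}=x_j+hv_j-\tfrac{h^2}{2}\nabla f(x_j),\qquad v_{j+1}=v_j-\tfrac h2\big(\nabla f(x_j)+\nabla f(x_{j+1})\big)$$ if $h>0$; if $h=0$, let $\tilde q_{T,0}(x,v)=x_T$,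 where $\dot x_t=v_t$, $\dot v_t=-\nabla f(x_t)$, $(x_0,v_0)=(x,v)$. The uHMC-v transition kernel $\tilde{\mathbf P}=\tilde{\mathbf P}_{T,h}$ maps a probability measure $\rho$ to the law $\rho\tilde{\mathbf P}$ of $\tilde q_{T,h}(X,\xi)$, where $X\sim\rho$ and $\xi\sim\mathcal N(0,I_d)$ are independent. **Theorem.** Suppose that * (a) $f$ has a global minimum at $0$ and $f(0)=0$; * (b), (c) $f\in C^3(\mathbb R^d)$, and $\|\nabla^2 f(x)\|_{\mathsf{op}}\le L$ and $\|\nabla^3 f(x)\|_{\mathsf{op}}\le M$ for all $x$ (operator norms of the derivatives as multilinear forms on Euclidean space); * $T>0$, $h\ge0$, $T/h\in\mathbb N$ if $h>0$, and $L(T^2+Th)\le\frac1{12}$; * $\tilde\nu_h$ is a probability measure with $\tilde\nu_h\tilde{\mathbf P}=\tilde\nu_h$, and $c_1\ge1$, $c_2>0$ are constants with $$W_\psi(\rho\tilde{\mathbf P}^k,\tilde\nu_h)\le c_1e^{-c_2k}\,W_\psi(\rho,\tilde\nu_h)\quad\text{for all integers }k\ge1\text{ and all probability measures }\rho\text{ on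 }\mathbb R^d.$$ Let $\mu$ be a probability measure on $\mathbb R^d$, let $1<q<\infty$ be real, and put $$\delta_1=(q-1)\Big(8dMT^2+\frac{3\sqrt d}{2T}\Big),\qquad \delta_2=\frac{9q(q-1)}{8T^2}.$$ Then for every integer $k\ge0$ with $$k\ \ge\ \frac1{c_2}\log\left(\frac{c_1W_\psi(\mu,\tilde\nu_h)}{4\sqrt{\log2}}\Big(\delta_1+\sqrt{\delta_1^2+16(\log2)\,\delta_2}\Big)\right)$$ (where $\log 0=-\infty$ and $\log\infty=\infty$) it holds that $$\mathsf R_q(\mu\tilde{\mathbf P}^{k+1}\,\|\,\tilde\nu_h)\ \le\ \frac{\delta_1+\delta_2}{q-1}\sqrt{\log2}\;c_1^2e^{-c_2k}\,\max\{1,W_\psi^2(\mu,\tilde\nu_h)\}.$$ -/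

import Mathlib

open MeasureTheory ProbabilityTheory Set
open scoped ENNReal Gradient

noncomputable section

/-! ### Orlicz norm and Orlicz-Wasserstein distance -/

/-- The Orlicz function `ψ(x) = exp(x²) - 1`. -/
def expSqOrlicz (x : ℝ) : ℝ := Real.exp (x ^ 2) - 1

/-- The Orlicz norm `‖X‖_ψ = inf {l > 0 : E[ψ(‖X‖ / l)] ≤ 1}` of a random vector `X` on `(Ω, P)`,
with value `∞` if there is no such `l`. -/
def orliczNorm {Ω E : Type*} [MeasurableSpace Ω] [NormedAddCommGroup E]
    (ψ : ℝ → ℝ) (X : Ω → E) (P : Measure Ω) : ℝ≥0∞ :=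
  ⨅ (l : ℝ) (_ : 0 < l ∧ ∫⁻ ω, ENNReal.ofReal (ψ (‖X ω‖ / l)) ∂P ≤ 1), ENNReal.ofReal l

/-- `γ` is a coupling of `μ` and `π`. -/
def IsCouplingOf {E : Type*} [MeasurableSpace E]
    (γ : Measure (E × E)) (μ π : Measure E) : Prop :=
  γ.map Prod.fst = μ ∧ γ.map Prod.snd = π

/-- The Orlicz-Wasserstein distance `W_ψ(μ, π)`, the infimum of `‖X - Y‖_ψ` over all couplings
`(X, Y)` of `μ` and `π`. -/
def orliczWasserstein {E : Type*} [NormedAddCommGroup E] [MeasurableSpace E]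
    (ψ : ℝ → ℝ) (μ π : Measure E) : ℝ≥0∞ :=
  ⨅ (γ : Measure (E × E)) (_ : IsCouplingOf γ μ π),
    orliczNorm ψ (fun p : E × E => p.1 - p.2) γ

/-! ### Rényi divergence -/

open Classical in
/-- The Rényi divergence of order `q` (used for `1 < q < ∞`),
`(q - 1)⁻¹ log E_π[(dμ/dπ)^q]` if `μ ≪ π`, and `∞` otherwise. -/
def renyiDiv {E : Type*} [MeasurableSpace E] (q : ℝ) (μ π : Measure E) : EReal :=
  if μ ≪ π then
    (((q - 1)⁻¹ : ℝ) : EReal) * ENNReal.log (∫⁻ x, (μ.rnDeriv π x) ^ q ∂π)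
  else ⊤

/-! ### Unadjusted Hamiltonian Monte Carlo with the velocity Verlet integrator -/

/-- One velocity Verlet step of size `h` for the potential `f`. -/
def verletStep {d : ℕ} (f : EuclideanSpace ℝ (Fin d) → ℝ) (h : ℝ)
    (p : EuclideanSpace ℝ (Fin d) × EuclideanSpace ℝ (Fin d)) :
    EuclideanSpace ℝ (Fin d) × EuclideanSpace ℝ (Fin d) :=
  let x' := p.1 + h • p.2 - (h ^ 2 / 2) • ∇ f p.1
  (x', p.2 - (h / 2) • (∇ f p.1 + ∇ f x'))

/-- The velocity Verlet flow over the time `T` with step size `h > 0` dividing `T`: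
`N = T / h` Verlet steps. -/
def verletFlow {d : ℕ} (f : EuclideanSpace ℝ (Fin d) → ℝ) (T h : ℝ) :
    EuclideanSpace ℝ (Fin d) × EuclideanSpace ℝ (Fin d) →
      EuclideanSpace ℝ (Fin d) × EuclideanSpace ℝ (Fin d) :=
  (verletStep f h)^[⌊T / h⌋₊]

/-- `(x_t, v_t)`, `0 ≤ t ≤ T`, solves the Hamiltonian dynamics `x' = v`, `v' = -∇ f(x)` with
initial condition `(x₀, v₀)`. -/
def IsHamiltonianTrajectory {d : ℕ} (f : EuclideanSpace ℝ (Fin d) → ℝ) (T : ℝ)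
    (x₀ v₀ : EuclideanSpace ℝ (Fin d)) (x v : ℝ → EuclideanSpace ℝ (Fin d)) : Prop :=
  x 0 = x₀ ∧ v 0 = v₀ ∧ ∀ t ∈ Icc 0 T,
    HasDerivWithinAt x (v t) (Icc 0 T) t ∧ HasDerivWithinAt v (-∇ f (x t)) (Icc 0 T) t

open Classical in
/-- The exact Hamiltonian flow at time `T`. The trajectory exists and is unique as soon as `∇ f` is
Lipschitz; the default value in the absence of a trajectory is irrelevant. -/
def hamiltonianFlow {d : ℕ} (f : EuclideanSpace ℝ (Fin d) → ℝ) (T : ℝ)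
    (p : EuclideanSpace ℝ (Fin d) × EuclideanSpace ℝ (Fin d)) :
    EuclideanSpace ℝ (Fin d) × EuclideanSpace ℝ (Fin d) :=
  if H : ∃ γ : (ℝ → EuclideanSpace ℝ (Fin d)) × (ℝ → EuclideanSpace ℝ (Fin d)),
      IsHamiltonianTrajectory f T p.1 p.2 γ.1 γ.2
  then (H.choose.1 T, H.choose.2 T) else p

open Classical in
/-- The position `q_{T,h}(x, v)` after time `T`, of the velocity Verlet flow with step size `h` if
`h > 0`, and of the exact Hamiltonian flow if `h = 0`. -/
def uhmcPosition {d : ℕ} (f : EuclideanSpace ℝ (Fin d) → ℝ) (T h : ℝ)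
    (p : EuclideanSpace ℝ (Fin d) × EuclideanSpace ℝ (Fin d)) : EuclideanSpace ℝ (Fin d) :=
  if h = 0 then (hamiltonianFlow f T p).1 else (verletFlow f T h p).1

/-- The transition operator `ρ ↦ ρ P_{T,h}` of uHMC-v: the law of `q_{T,h}(X, ξ)`, where `X ∼ ρ`
and `ξ` is an independent standard Gaussian vector. -/
def uhmcKernel {d : ℕ} (f : EuclideanSpace ℝ (Fin d) → ℝ) (T h : ℝ)
    (ρ : Measure (EuclideanSpace ℝ (Fin d))) : Measure (EuclideanSpace ℝ (Fin d)) :=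
  (ρ.prod (stdGaussian (EuclideanSpace ℝ (Fin d)))).map (uhmcPosition f T h)

/-! ### Assumptions -/

/-- The potential `f` has a global minimum at `0` with `f(0) = 0`, is three times continuously
differentiable, and its second and third derivatives are bounded in operator norm by `L` and `M`. -/
structure PotentialAssumption {d : ℕ} (f : EuclideanSpace ℝ (Fin d) → ℝ) (L M : ℝ) : Prop where
  isMin : ∀ x, f 0 ≤ f x
  zero : f 0 = 0
  contDiff : ContDiff ℝ 3 f
  hess_le : ∀ x, ‖iteratedFDeriv ℝ 2 f x‖ ≤ L
  third_le : ∀ x, ‖iteratedFDeriv ℝ 3 f x‖ ≤ M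

/-- `ν` is a stationary probability distribution of the transition operator `Q`, and `Q` contracts
exponentially towards `ν` in the Orlicz-Wasserstein distance for `ψ(x) = exp(x²) - 1`, with
constants `c₁ ≥ 1` and `c₂ > 0`. -/
structure OrliczMixing {d : ℕ}
    (Q : Measure (EuclideanSpace ℝ (Fin d)) → Measure (EuclideanSpace ℝ (Fin d)))
    (ν : Measure (EuclideanSpace ℝ (Fin d))) (c₁ c₂ : ℝ) : Prop where
  isProbabilityMeasure : IsProbabilityMeasure ν
  stationary : Q ν = ν
  one_le : 1 ≤ c₁
  pos : 0 < c₂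
  contraction : ∀ (ρ : Measure (EuclideanSpace ℝ (Fin d))), IsProbabilityMeasure ρ →
    ∀ k : ℕ, 1 ≤ k →
      orliczWasserstein expSqOrlicz (Q^[k] ρ) ν
        ≤ ENNReal.ofReal (c₁ * Real.exp (-c₂ * k)) * orliczWasserstein expSqOrlicz ρ ν

end

/-!
One uHMC-v transition from a point `x` is the image of a Gaussian velocity `u` under the position
map `u ↦ q(x, u)`. Over a time with `L T² ≤ 1 / 12` this map is `T` times a small Lipschitz
perturbation of the identity, because in the Verlet recursion, as in Newton's equation, a force
bounded by `C` displaces the free motion by at most `C T² / 2` (`norm_sub_free_motion_le`). Hence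
for two starting points there is a change of velocity `u ↦ S u` with `q(y, S u) = q(x, u)`; it moves
`u` by at most `3 ‖x - y‖ / (2 T)`, and the bound on the third derivative of `f` gives
`|det DS|⁻¹ ≤ exp(8 d M T² ‖x - y‖)` (`exists_velocity_change`).

Changing variables along `S`, and using the Gaussian concentration bound
`E exp(a ‖ξ‖) ≤ exp(a √d + a² / 2)` (`lintegral_exp_norm_stdGaussian_le`), one obtains a Harnack
inequality with power for test functions `ψ ≥ 0`,
`E ψ(q(x, ξ)) ≤ exp(δ₁ r + δ₂ r²) ^ (1 / q) * (E ψ(q(y, ξ)) ^ (q / (q - 1))) ^ ((q - 1) / q)`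
with `r = ‖x - y‖`, which is the dual form of a Rényi bound between the two transition laws. For
continuous `ψ` it is stable under pointwise convergence of the position maps, so the exact flow is
covered as the limit of Verlet flows (`lintegral_uhmcPosition_le`), and no differentiability of the
exact flow in its initial data is needed.

Hölder's inequality integrates this over a coupling of `μ Pᵏ` with the stationary law `ν`
(`lintegral_map_le_of_coupling`), and testing with truncated powers of the density gives
`∫ (d(μ Pᵏ⁺¹) / dν) ^ q dν ≤ E exp(δ₁ Z + δ₂ Z²)` where `Z` is the distance under the coupling
(`lintegral_rnDeriv_rpow_le`). If `‖Z‖_ψ ≤ w` and `δ₁ w / (2 √log 2) + δ₂ w² ≤ 1`, Jensen's inequality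
bounds the right side by `exp(√log 2 δ₁ w + log 2 δ₂ w²)`. The lower bound on `k` is exactly what
makes this condition hold for `w = c₁ exp(-c₂ k) W_ψ(μ, ν)`.
-/

noncomputable section

/-! ### The Verlet recursion -/

section Recursion

variable {V : Type*} [NormedAddCommGroup V] [NormedSpace ℝ V]

/-- Two summations of a perturbed free motion: a forcing of size `C` displaces the position at time
`j h` by at most `C (j h)² / 2`, exactly as in continuous time. -/
theorem norm_sub_free_motion_le {h C : ℝ} (hh : 0 ≤ h) {N : ℕ} {a b A B : ℕ → V}
    (ha : ∀ j < N, a (j + 1) = a j + h • b j - A j) (hb : ∀ j < N, b (j + 1) = b j - B j)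
    (hA : ∀ j < N, ‖A j‖ ≤ C * h ^ 2 / 2) (hB : ∀ j < N, ‖B j‖ ≤ C * h) :
    ∀ j ≤ N, ‖a j - a 0 - (j * h) • b 0‖ ≤ C * (j * h) ^ 2 / 2 ∧ ‖b j - b 0‖ ≤ C * (j * h) := by
  intro j
  induction j with
  | zero => intro _; simp
  | succ j ih =>
    intro hj
    obtain ⟨ih1, ih2⟩ := ih (by omega)
    have hj' : j < N := by omega
    constructor
    · have e : a (j + 1) - a 0 - ((j + 1 : ℕ) * h) • b 0
          = (a j - a 0 - (j * h) • b 0) + h • (b j - b 0) - A j := by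
        rw [ha j hj']; push_cast; module
      rw [e]
      calc _ ≤ ‖a j - a 0 - (j * h) • b 0‖ + h * ‖b j - b 0‖ + ‖A j‖ := by
            refine (norm_sub_le _ _).trans ?_
            gcongr
            refine (norm_add_le _ _).trans ?_
            rw [norm_smul, Real.norm_of_nonneg hh]
        _ ≤ C * (j * h) ^ 2 / 2 + h * (C * (j * h)) + C * h ^ 2 / 2 := by
            gcongr
            exact hA j hj'
        _ = _ := by push_cast; ring
    · have e : b (j + 1) - b 0 = (b j - b 0) - B j := by rw [hb j hj']; module
      rw [e]
      calc _ ≤ ‖b j - b 0‖ + ‖B j‖ := norm_sub_le _ _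
        _ ≤ C * (j * h) + C * h := add_le_add ih2 (hB j hj')
        _ = _ := by push_cast; ring

/-- A discrete Grönwall bound for the Verlet recursion over a short time `T`, `L T² ≤ 1 / 12`: the
maximum `Z` of `‖a j‖` satisfies `Z ≤ ‖a 0‖ + T ‖b 0‖ + (L Z + K) T² / 2`, and `24 / 23` is the
inverse of `1 - 1 / 24 ≤ 1 - L T² / 2`. -/
theorem norm_le_of_perturbed_recursion {h T L K : ℝ} (hh : 0 ≤ h) {N : ℕ} (hN : N * h = T)
    (hL : 0 ≤ L) (hK : 0 ≤ K) (hLT : L * T ^ 2 ≤ 1 / 12) {a b A B : ℕ → V}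
    (ha : ∀ j < N, a (j + 1) = a j + h • b j - A j) (hb : ∀ j < N, b (j + 1) = b j - B j)
    (hA : ∀ Z, (∀ j ≤ N, ‖a j‖ ≤ Z) → ∀ j < N, ‖A j‖ ≤ (L * Z + K) * h ^ 2 / 2)
    (hB : ∀ Z, (∀ j ≤ N, ‖a j‖ ≤ Z) → ∀ j < N, ‖B j‖ ≤ (L * Z + K) * h) :
    (∀ j ≤ N, ‖a j‖ ≤ 24 / 23 * (‖a 0‖ + T * ‖b 0‖ + K * T ^ 2 / 2)) ∧
    ‖a N - a 0 - T • b 0‖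
      ≤ (L * (24 / 23 * (‖a 0‖ + T * ‖b 0‖ + K * T ^ 2 / 2)) + K) * T ^ 2 / 2 := by
  obtain ⟨m, hm, hmax⟩ := (Finset.range (N + 1)).exists_max_image (fun j => ‖a j‖) ⟨0, by simp⟩
  have hZ : ∀ j ≤ N, ‖a j‖ ≤ ‖a m‖ := fun j hj => hmax j (by simpa [Nat.lt_succ_iff] using hj)
  have hm' : m ≤ N := by simpa [Nat.lt_succ_iff] using hm
  have key := (norm_sub_free_motion_le hh ha hb (hA _ hZ) (hB _ hZ) m hm').1
  have hmT : (m : ℝ) * h ≤ T := by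
    rw [← hN]; gcongr
  have hT0 : 0 ≤ T := by rw [← hN]; positivity
  have h0 : 0 ≤ (m : ℝ) * h := by positivity
  have hsq : ((m : ℝ) * h) ^ 2 ≤ T ^ 2 := by gcongr
  have h1 : ‖a m‖ ≤ ‖a 0‖ + T * ‖b 0‖ + (L * ‖a m‖ + K) * T ^ 2 / 2 := by
    have e : a m = (a m - a 0 - (m * h) • b 0) + (a 0 + (m * h) • b 0) := by module
    calc ‖a m‖ = ‖(a m - a 0 - (m * h) • b 0) + (a 0 + (m * h) • b 0)‖ := by rw [← e]
      _ ≤ (L * ‖a m‖ + K) * (m * h) ^ 2 / 2 + (‖a 0‖ + (m * h) * ‖b 0‖) := by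
          refine (norm_add_le _ _).trans (add_le_add key ((norm_add_le _ _).trans ?_))
          rw [norm_smul, Real.norm_of_nonneg h0]
      _ ≤ (L * ‖a m‖ + K) * T ^ 2 / 2 + (‖a 0‖ + T * ‖b 0‖) := by gcongr
      _ = _ := by ring
  have h2 : ‖a m‖ ≤ 24 / 23 * (‖a 0‖ + T * ‖b 0‖ + K * T ^ 2 / 2) := by
    have : L * T ^ 2 * ‖a m‖ ≤ 1 / 12 * ‖a m‖ := by gcongr
    nlinarith
  have h3 : ∀ j ≤ N, ‖a j‖ ≤ 24 / 23 * (‖a 0‖ + T * ‖b 0‖ + K * T ^ 2 / 2) :=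
    fun j hj => (hZ j hj).trans h2
  refine ⟨h3, ?_⟩
  have := (norm_sub_free_motion_le hh ha hb (hA _ h3) (hB _ h3) N le_rfl).1
  rwa [hN] at this

/-- The bound for an unperturbed Verlet recursion with force `G j` controlled by the position. -/
theorem norm_le_of_verlet_recursion {h T L K : ℝ} (hh : 0 ≤ h) {N : ℕ} (hN : N * h = T)
    (hL : 0 ≤ L) (hK : 0 ≤ K) (hLT : L * T ^ 2 ≤ 1 / 12) {a b G : ℕ → V}
    (ha : ∀ j, a (j + 1) = a j + h • b j - (h ^ 2 / 2) • G j)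
    (hb : ∀ j, b (j + 1) = b j - (h / 2) • (G j + G (j + 1)))
    (hG : ∀ j ≤ N, ‖G j‖ ≤ L * ‖a j‖ + K) :
    (∀ j ≤ N, ‖a j‖ ≤ 24 / 23 * (‖a 0‖ + T * ‖b 0‖ + K * T ^ 2 / 2)) ∧
    ‖a N - a 0 - T • b 0‖
      ≤ (L * (24 / 23 * (‖a 0‖ + T * ‖b 0‖ + K * T ^ 2 / 2)) + K) * T ^ 2 / 2 := by
  have hGZ : ∀ Z, (∀ j ≤ N, ‖a j‖ ≤ Z) → ∀ j ≤ N, ‖G j‖ ≤ L * Z + K := by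
    intro Z hZ j hj
    refine (hG j hj).trans ?_
    gcongr
    exact hZ j hj
  refine norm_le_of_perturbed_recursion hh hN hL hK hLT (fun j _ => ha j) (fun j _ => hb j) ?_ ?_
  · intro Z hZ j hj
    rw [norm_smul, Real.norm_of_nonneg (by positivity)]
    have := mul_le_mul_of_nonneg_left (hGZ Z hZ j hj.le) (by positivity : 0 ≤ h ^ 2 / 2)
    linarith
  · intro Z hZ j hj
    rw [norm_smul, Real.norm_of_nonneg (by positivity)]
    have := mul_le_mul_of_nonneg_left ((norm_add_le _ _).trans
      (add_le_add (hGZ Z hZ j hj.le) (hGZ Z hZ (j + 1) hj))) (by positivity : 0 ≤ h / 2)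
    linarith

end Recursion

/-! ### Derivative bounds on the gradient -/

section Grad

variable {d : ℕ}

/-- Riesz representation as a real-linear isometry. -/
def rieszIso (d : ℕ) : (EuclideanSpace ℝ (Fin d) →L[ℝ] ℝ) ≃ₗᵢ[ℝ] EuclideanSpace ℝ (Fin d) where
  toFun := (InnerProductSpace.toDual ℝ (EuclideanSpace ℝ (Fin d))).symm
  invFun := InnerProductSpace.toDual ℝ (EuclideanSpace ℝ (Fin d))
  left_inv := by intro x; simp
  right_inv := by intro x; simp
  map_add' := by intro x y; simp
  map_smul' := by intro c x; simp
  norm_map' := by intro x; simp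

/-- The Hessian of `f` as a field of endomorphisms. -/
def hessian {d : ℕ} (f : EuclideanSpace ℝ (Fin d) → ℝ) (x : EuclideanSpace ℝ (Fin d)) :
    EuclideanSpace ℝ (Fin d) →L[ℝ] EuclideanSpace ℝ (Fin d) :=
  fderiv ℝ (∇ f) x

variable {f : EuclideanSpace ℝ (Fin d) → ℝ} {L M : ℝ}

theorem gradient_eq_rieszIso_comp (f : EuclideanSpace ℝ (Fin d) → ℝ) :
    ∇ f = rieszIso d ∘ fderiv ℝ f := rfl

namespace PotentialAssumption

theorem nonneg_hess (hf : PotentialAssumption f L M) : 0 ≤ L := (norm_nonneg _).trans (hf.hess_le 0)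

theorem nonneg_third (hf : PotentialAssumption f L M) : 0 ≤ M :=
  (norm_nonneg _).trans (hf.third_le 0)

theorem contDiff_gradient (hf : PotentialAssumption f L M) : ContDiff ℝ 2 (∇ f) := by
  rw [gradient_eq_rieszIso_comp]
  exact (rieszIso d).contDiff.comp (hf.contDiff.fderiv_right (by norm_num))

theorem hasFDerivAt_gradient (hf : PotentialAssumption f L M) (x : EuclideanSpace ℝ (Fin d)) :
    HasFDerivAt (∇ f) (hessian f x) x :=
  ((hf.contDiff_gradient.differentiable (by norm_num)) x).hasFDerivAt

theorem continuous_gradient (hf : PotentialAssumption f L M) : Continuous (∇ f) :=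
  hf.contDiff_gradient.continuous

theorem norm_hessian_le (hf : PotentialAssumption f L M) (x : EuclideanSpace ℝ (Fin d)) :
    ‖hessian f x‖ ≤ L := by
  have := hf.hess_le x
  rw [hessian, ← norm_iteratedFDeriv_one, gradient_eq_rieszIso_comp,
    (rieszIso d).norm_iteratedFDeriv_comp_left, norm_iteratedFDeriv_fderiv]
  exact this

theorem norm_hessian_sub_le (hf : PotentialAssumption f L M) (x y : EuclideanSpace ℝ (Fin d)) :
    ‖hessian f x - hessian f y‖ ≤ M * ‖x - y‖ := by
  have hd : Differentiable ℝ (hessian f) :=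
    (hf.contDiff_gradient.fderiv_right (m := 1) (by norm_num)).differentiable (by norm_num)
  refine Convex.norm_image_sub_le_of_norm_fderiv_le (𝕜 := ℝ) (s := univ) (fun z _ => hd z)
    (fun z _ => ?_) convex_univ (mem_univ _) (mem_univ _)
  have := hf.third_le z
  rw [← norm_iteratedFDeriv_one]
  change ‖iteratedFDeriv ℝ 1 (fderiv ℝ (∇ f)) z‖ ≤ M
  rw [norm_iteratedFDeriv_fderiv, gradient_eq_rieszIso_comp,
    (rieszIso d).norm_iteratedFDeriv_comp_left, norm_iteratedFDeriv_fderiv]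
  exact this

theorem norm_gradient_sub_le (hf : PotentialAssumption f L M) (x y : EuclideanSpace ℝ (Fin d)) :
    ‖∇ f x - ∇ f y‖ ≤ L * ‖x - y‖ :=
  Convex.norm_image_sub_le_of_norm_hasFDerivWithin_le (𝕜 := ℝ) (s := univ)
    (fun z _ => (hf.hasFDerivAt_gradient z).hasFDerivWithinAt)
    (fun z _ => hf.norm_hessian_le z) convex_univ (mem_univ _) (mem_univ _)

end PotentialAssumption

end Grad

/-! ### Verlet trajectories and their derivative in the initial velocity -/

section Verlet

variable {d : ℕ} {f : EuclideanSpace ℝ (Fin d) → ℝ} {L M h T : ℝ} {N : ℕ}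

theorem verletStep_iterate_succ_fst (f : EuclideanSpace ℝ (Fin d) → ℝ) (h : ℝ)
    (p : EuclideanSpace ℝ (Fin d) × EuclideanSpace ℝ (Fin d)) (j : ℕ) :
    ((verletStep f h)^[j + 1] p).1 = ((verletStep f h)^[j] p).1 + h • ((verletStep f h)^[j] p).2
      - (h ^ 2 / 2) • ∇ f ((verletStep f h)^[j] p).1 := by
  rw [Function.iterate_succ_apply']; rfl

theorem verletStep_iterate_succ_snd (f : EuclideanSpace ℝ (Fin d) → ℝ) (h : ℝ)
    (p : EuclideanSpace ℝ (Fin d) × EuclideanSpace ℝ (Fin d)) (j : ℕ) :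
    ((verletStep f h)^[j + 1] p).2 = ((verletStep f h)^[j] p).2
      - (h / 2) • (∇ f ((verletStep f h)^[j] p).1 + ∇ f ((verletStep f h)^[j + 1] p).1) := by
  rw [verletStep_iterate_succ_fst, Function.iterate_succ_apply']; rfl

theorem continuous_verletStep (hf : PotentialAssumption f L M) (h : ℝ) :
    Continuous (verletStep f h) := by
  have := hf.continuous_gradient
  unfold verletStep
  fun_prop

/-- Stability of Verlet trajectories under a change of the initial data. -/
theorem norm_verlet_sub_le (hf : PotentialAssumption f L M) (hh : 0 ≤ h) (hN : N * h = T)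
    (hLT : L * T ^ 2 ≤ 1 / 12) (p p' : EuclideanSpace ℝ (Fin d) × EuclideanSpace ℝ (Fin d)) :
    (∀ j ≤ N, ‖((verletStep f h)^[j] p).1 - ((verletStep f h)^[j] p').1‖
      ≤ 24 / 23 * (‖p.1 - p'.1‖ + T * ‖p.2 - p'.2‖)) ∧
    ‖((verletStep f h)^[N] p).1 - ((verletStep f h)^[N] p').1 - (p.1 - p'.1) - T • (p.2 - p'.2)‖
      ≤ 1 / 23 * (‖p.1 - p'.1‖ + T * ‖p.2 - p'.2‖) := by
  have hT0 : 0 ≤ T := by rw [← hN]; positivity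
  obtain ⟨h1, h2⟩ := norm_le_of_verlet_recursion (V := EuclideanSpace ℝ (Fin d)) (K := 0)
    (a := fun j => ((verletStep f h)^[j] p).1 - ((verletStep f h)^[j] p').1)
    (b := fun j => ((verletStep f h)^[j] p).2 - ((verletStep f h)^[j] p').2)
    (G := fun j => ∇ f ((verletStep f h)^[j] p).1 - ∇ f ((verletStep f h)^[j] p').1)
    hh hN hf.nonneg_hess le_rfl hLT
    (fun j => by simp only [verletStep_iterate_succ_fst]; module)
    (fun j => by
      simp only [verletStep_iterate_succ_snd f h p, verletStep_iterate_succ_snd f h p']; module)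
    (fun j _ => by simpa using hf.norm_gradient_sub_le _ _)
  simp only [zero_mul, zero_div, add_zero, Function.iterate_zero, id] at h1 h2
  refine ⟨h1, h2.trans ?_⟩
  have h0 : 0 ≤ ‖p.1 - p'.1‖ + T * ‖p.2 - p'.2‖ := by positivity
  nlinarith [mul_le_mul_of_nonneg_right hLT h0]

/-- The derivatives of the positions and velocities along the Verlet trajectory with respect to the
initial velocity, given by the linearised recursion. -/
def verletTangent (f : EuclideanSpace ℝ (Fin d) → ℝ) (h : ℝ)
    (p : EuclideanSpace ℝ (Fin d) × EuclideanSpace ℝ (Fin d)) : ℕ →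
    (EuclideanSpace ℝ (Fin d) →L[ℝ] EuclideanSpace ℝ (Fin d)) ×
      (EuclideanSpace ℝ (Fin d) →L[ℝ] EuclideanSpace ℝ (Fin d))
  | 0 => (0, ContinuousLinearMap.id ℝ _)
  | j + 1 =>
    let a := (verletTangent f h p j).1
    let b := (verletTangent f h p j).2
    let a' := a + h • b - (h ^ 2 / 2) • (hessian f ((verletStep f h)^[j] p).1 ∘L a)
    (a', b - (h / 2) • (hessian f ((verletStep f h)^[j] p).1 ∘L a
      + hessian f ((verletStep f h)^[j + 1] p).1 ∘L a'))

theorem verletTangent_succ_fst (f : EuclideanSpace ℝ (Fin d) → ℝ) (h : ℝ)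
    (p : EuclideanSpace ℝ (Fin d) × EuclideanSpace ℝ (Fin d)) (j : ℕ) :
    (verletTangent f h p (j + 1)).1 = (verletTangent f h p j).1 + h • (verletTangent f h p j).2
      - (h ^ 2 / 2) • (hessian f ((verletStep f h)^[j] p).1 ∘L (verletTangent f h p j).1) := rfl

theorem verletTangent_succ_snd (f : EuclideanSpace ℝ (Fin d) → ℝ) (h : ℝ)
    (p : EuclideanSpace ℝ (Fin d) × EuclideanSpace ℝ (Fin d)) (j : ℕ) :
    (verletTangent f h p (j + 1)).2 = (verletTangent f h p j).2
      - (h / 2) • (hessian f ((verletStep f h)^[j] p).1 ∘L (verletTangent f h p j).1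
        + hessian f ((verletStep f h)^[j + 1] p).1 ∘L (verletTangent f h p (j + 1)).1) := rfl

theorem hasFDerivAt_verlet (hf : PotentialAssumption f L M) (h : ℝ)
    (x u : EuclideanSpace ℝ (Fin d)) (j : ℕ) :
    HasFDerivAt (fun w => ((verletStep f h)^[j] (x, w)).1) (verletTangent f h (x, u) j).1 u ∧
    HasFDerivAt (fun w => ((verletStep f h)^[j] (x, w)).2) (verletTangent f h (x, u) j).2 u := by
  induction j with
  | zero => exact ⟨hasFDerivAt_const _ _, hasFDerivAt_id _⟩
  | succ j ih =>
    obtain ⟨i1, i2⟩ := ih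
    have g1 : HasFDerivAt (fun w => ∇ f ((verletStep f h)^[j] (x, w)).1)
        (hessian f ((verletStep f h)^[j] (x, u)).1 ∘L (verletTangent f h (x, u) j).1) u :=
      (hf.hasFDerivAt_gradient _).comp u i1
    have k1 : HasFDerivAt (fun w => ((verletStep f h)^[j + 1] (x, w)).1)
        (verletTangent f h (x, u) (j + 1)).1 u := by
      simp only [verletStep_iterate_succ_fst, verletTangent_succ_fst]
      exact (i1.add (i2.const_smul h)).sub (g1.const_smul (h ^ 2 / 2))
    have g2 : HasFDerivAt (fun w => ∇ f ((verletStep f h)^[j + 1] (x, w)).1)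
        (hessian f ((verletStep f h)^[j + 1] (x, u)).1 ∘L (verletTangent f h (x, u) (j + 1)).1) u :=
      (hf.hasFDerivAt_gradient _).comp u k1
    refine ⟨k1, ?_⟩
    simp only [verletStep_iterate_succ_snd, verletTangent_succ_snd]
    exact i2.sub ((g1.add g2).const_smul (h / 2))

theorem norm_verletTangent_le (hf : PotentialAssumption f L M) (hh : 0 ≤ h) (hN : N * h = T)
    (hLT : L * T ^ 2 ≤ 1 / 12) (p : EuclideanSpace ℝ (Fin d) × EuclideanSpace ℝ (Fin d)) :
    (∀ j ≤ N, ‖(verletTangent f h p j).1‖ ≤ 24 / 23 * T) ∧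
    ‖(verletTangent f h p N).1 - T • ContinuousLinearMap.id ℝ _‖ ≤ 1 / 23 * T := by
  have hT0 : 0 ≤ T := by rw [← hN]; positivity
  obtain ⟨h1, h2⟩ := norm_le_of_verlet_recursion (K := 0)
    (a := fun j => (verletTangent f h p j).1) (b := fun j => (verletTangent f h p j).2)
    (G := fun j => hessian f ((verletStep f h)^[j] p).1 ∘L (verletTangent f h p j).1)
    hh hN hf.nonneg_hess le_rfl hLT
    (fun j => verletTangent_succ_fst f h p j) (fun j => verletTangent_succ_snd f h p j)
    (fun j _ => by
      rw [add_zero]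
      exact (ContinuousLinearMap.opNorm_comp_le _ _).trans
        (mul_le_mul_of_nonneg_right (hf.norm_hessian_le _) (norm_nonneg _)))
  have hid : ‖ContinuousLinearMap.id ℝ (EuclideanSpace ℝ (Fin d))‖ ≤ 1 :=
    ContinuousLinearMap.norm_id_le
  have hT1 : T * ‖ContinuousLinearMap.id ℝ (EuclideanSpace ℝ (Fin d))‖ ≤ T :=
    mul_le_of_le_one_right hT0 hid
  simp only [zero_mul, zero_div, add_zero, verletTangent, norm_zero, zero_add, sub_zero] at h1 h2
  refine ⟨fun j hj => (h1 j hj).trans (by gcongr), h2.trans ?_⟩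
  have := mul_le_mul hLT hT1 (by positivity) (by norm_num)
  nlinarith

/-- Lipschitz dependence of the velocity derivative on the initial data; the third derivative of the
potential enters through the variation of the Hessian between the two trajectories. -/
theorem norm_verletTangent_sub_le (hf : PotentialAssumption f L M) (hh : 0 ≤ h) (hN : N * h = T)
    (hLT : L * T ^ 2 ≤ 1 / 12) (p p' : EuclideanSpace ℝ (Fin d) × EuclideanSpace ℝ (Fin d)) :
    ‖(verletTangent f h p N).1 - (verletTangent f h p' N).1‖
      ≤ (24 / 23) ^ 3 * (M * T ^ 3 / 2) * (‖p.1 - p'.1‖ + T * ‖p.2 - p'.2‖) := by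
  have hT0 : 0 ≤ T := by rw [← hN]; positivity
  have hM := hf.nonneg_third
  set D := ‖p.1 - p'.1‖ + T * ‖p.2 - p'.2‖
  have hD0 : 0 ≤ D := by positivity
  have hG : ∀ j ≤ N, ‖hessian f ((verletStep f h)^[j] p).1 ∘L (verletTangent f h p j).1
      - hessian f ((verletStep f h)^[j] p').1 ∘L (verletTangent f h p' j).1‖
      ≤ L * ‖(verletTangent f h p j).1 - (verletTangent f h p' j).1‖
        + M * (24 / 23 * D) * (24 / 23 * T) := by
    intro j hj
    have e : hessian f ((verletStep f h)^[j] p).1 ∘L (verletTangent f h p j).1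
        - hessian f ((verletStep f h)^[j] p').1 ∘L (verletTangent f h p' j).1
        = hessian f ((verletStep f h)^[j] p).1 ∘L
            ((verletTangent f h p j).1 - (verletTangent f h p' j).1)
          + (hessian f ((verletStep f h)^[j] p).1 - hessian f ((verletStep f h)^[j] p').1) ∘L
            (verletTangent f h p' j).1 := by
      rw [ContinuousLinearMap.comp_sub, ContinuousLinearMap.sub_comp]; abel
    rw [e]
    refine (norm_add_le _ _).trans (add_le_add ?_ ?_)
    · exact (ContinuousLinearMap.opNorm_comp_le _ _).trans
        (mul_le_mul_of_nonneg_right (hf.norm_hessian_le _) (norm_nonneg _))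
    · refine (ContinuousLinearMap.opNorm_comp_le _ _).trans ?_
      refine mul_le_mul ((hf.norm_hessian_sub_le _ _).trans ?_)
        ((norm_verletTangent_le hf hh hN hLT p').1 j hj) (norm_nonneg _) (by positivity)
      exact mul_le_mul_of_nonneg_left ((norm_verlet_sub_le hf hh hN hLT p p').1 j hj) hM
  obtain ⟨h1, -⟩ := norm_le_of_verlet_recursion
    (a := fun j => (verletTangent f h p j).1 - (verletTangent f h p' j).1)
    (b := fun j => (verletTangent f h p j).2 - (verletTangent f h p' j).2)
    (G := fun j => hessian f ((verletStep f h)^[j] p).1 ∘L (verletTangent f h p j).1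
      - hessian f ((verletStep f h)^[j] p').1 ∘L (verletTangent f h p' j).1)
    hh hN hf.nonneg_hess (by positivity) hLT
    (fun j => by simp only [verletTangent_succ_fst]; module)
    (fun j => by simp only [verletTangent_succ_snd f h p, verletTangent_succ_snd f h p']; module)
    hG
  refine (h1 N le_rfl).trans (le_of_eq ?_)
  simp only [verletTangent, sub_self, norm_zero]
  ring

/-! ### Change of variables between two starting points -/

/-- `|det B| ≤ ‖B‖ ^ d`, by comparing the volume of a ball with that of its image. -/
theorem abs_det_le_norm_pow (B : EuclideanSpace ℝ (Fin d) →L[ℝ] EuclideanSpace ℝ (Fin d)) :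
    |B.det| ≤ ‖B‖ ^ d := by
  have h1 : B '' Metric.closedBall 0 1 ⊆ Metric.closedBall 0 ‖B‖ := by
    rintro _ ⟨v, hv, rfl⟩
    rw [mem_closedBall_zero_iff] at hv ⊢
    exact B.le_of_opNorm_le_of_le le_rfl hv |>.trans (by simp)
  have h2 := measure_mono (μ := (volume : Measure (EuclideanSpace ℝ (Fin d)))) h1
  rw [Measure.addHaar_image_continuousLinearMap,
    Measure.addHaar_closedBall _ _ (norm_nonneg _), Measure.addHaar_closedBall _ _ zero_le_one,
    one_pow, ENNReal.ofReal_one, one_mul] at h2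
  have h3 := (ENNReal.mul_le_mul_iff_left (Metric.measure_ball_pos volume
    (0 : EuclideanSpace ℝ (Fin d)) zero_lt_one).ne' Metric.isBounded_ball.measure_lt_top.ne).1 h2
  rw [ENNReal.ofReal_le_ofReal_iff (by positivity)] at h3
  simpa using h3

theorem abs_det_le_exp {B : EuclideanSpace ℝ (Fin d) →L[ℝ] EuclideanSpace ℝ (Fin d)} {ε : ℝ}
    (hB : ‖B - ContinuousLinearMap.id ℝ _‖ ≤ ε) : |B.det| ≤ Real.exp (d * ε) := by
  have h1 : ‖B‖ ≤ Real.exp ε := by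
    have e : B = (B - ContinuousLinearMap.id ℝ _) + ContinuousLinearMap.id ℝ _ := by abel
    calc ‖B‖ = ‖(B - ContinuousLinearMap.id ℝ _) + ContinuousLinearMap.id ℝ _‖ := by rw [← e]
      _ ≤ ε + 1 := (norm_add_le _ _).trans (add_le_add hB ContinuousLinearMap.norm_id_le)
      _ ≤ _ := Real.add_one_le_exp ε
  calc |B.det| ≤ ‖B‖ ^ d := abs_det_le_norm_pow B
    _ ≤ Real.exp ε ^ d := by gcongr
    _ = _ := by rw [← Real.exp_nat_mul]

/-- If `A` is close to `T • id`, then `|det A'| ≤ exp(d ε) |det A|` with `ε` of the order of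
`‖A' - A‖ / T`. -/
theorem abs_det_le_exp_mul_abs_det {A A' : EuclideanSpace ℝ (Fin d) →L[ℝ] EuclideanSpace ℝ (Fin d)}
    (hT : 0 < T) {ε : ℝ} (hA : ‖A - T • ContinuousLinearMap.id ℝ _‖ ≤ 1 / 23 * T)
    (hε : ‖A' - A‖ ≤ 22 / 23 * T * ε) :
    A.det ≠ 0 ∧ |A'.det| ≤ Real.exp (d * ε) * |A.det| := by
  -- the perturbation `T / 23` leaves the lower bound `22 T / 23`, hence invertibility
  have hlow : ∀ v, 22 / 23 * T * ‖v‖ ≤ ‖A v‖ := by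
    intro v
    have h1 : ‖(A - T • ContinuousLinearMap.id ℝ (EuclideanSpace ℝ (Fin d))) v‖ ≤ 1 / 23 * T * ‖v‖ :=
      ContinuousLinearMap.le_of_opNorm_le _ hA v
    have h2 : ‖T • v‖ ≤ ‖A v‖ + ‖(A - T • ContinuousLinearMap.id ℝ (EuclideanSpace ℝ (Fin d))) v‖ := by
      have e : T • v = A v - (A - T • ContinuousLinearMap.id ℝ (EuclideanSpace ℝ (Fin d))) v := by simp
      rw [e]; exact norm_sub_le _ _
    rw [norm_smul, Real.norm_of_nonneg hT.le] at h2
    linarith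
  have hinj : Function.Injective A := by
    rw [injective_iff_map_eq_zero]
    intro v hv
    have := hlow v
    rw [hv, norm_zero] at this
    have h3 : 0 < 22 / 23 * T := by positivity
    exact norm_le_zero_iff.1 (by nlinarith [norm_nonneg v])
  have hdet : A.det ≠ 0 := by
    have : IsUnit (A : EuclideanSpace ℝ (Fin d) →ₗ[ℝ] EuclideanSpace ℝ (Fin d)) := by
      rw [Module.End.isUnit_iff]
      exact ⟨hinj, LinearMap.injective_iff_surjective.1 hinj⟩
    exact (LinearMap.isUnit_iff_isUnit_det _).1 this |>.ne_zero
  refine ⟨hdet, ?_⟩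
  set e := A.toContinuousLinearEquivOfDetNeZero hdet
  have heA : ∀ v, A (e.symm v) = v := fun v => e.apply_symm_apply v
  set B : EuclideanSpace ℝ (Fin d) →L[ℝ] EuclideanSpace ℝ (Fin d) :=
    (e.symm : EuclideanSpace ℝ (Fin d) →L[ℝ] EuclideanSpace ℝ (Fin d)) ∘L A' with hBdef
  have hAB : A' = A ∘L B := by
    ext1 v
    simp [hBdef, heA]
  have hε0 : 0 ≤ ε := by
    have : 0 ≤ 22 / 23 * T * ε := (norm_nonneg _).trans hε
    exact nonneg_of_mul_nonneg_right this (by positivity)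
  have hB : ‖B - ContinuousLinearMap.id ℝ (EuclideanSpace ℝ (Fin d))‖ ≤ ε := by
    refine ContinuousLinearMap.opNorm_le_bound _ hε0 fun v => ?_
    have h1 := hlow ((B - ContinuousLinearMap.id ℝ (EuclideanSpace ℝ (Fin d))) v)
    have h2 : A ((B - ContinuousLinearMap.id ℝ (EuclideanSpace ℝ (Fin d))) v) = (A' - A) v := by
      rw [hAB]; simp
    rw [h2] at h1
    have h3 : ‖(A' - A) v‖ ≤ 22 / 23 * T * ε * ‖v‖ := ContinuousLinearMap.le_of_opNorm_le _ hε v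
    have h4 : 0 < 22 / 23 * T := by positivity
    nlinarith
  have hmul : A'.det = A.det * B.det := by
    rw [hAB]; exact LinearMap.det_comp _ _
  rw [hmul, abs_mul, mul_comm]
  gcongr
  exact abs_det_le_exp hB

/-- For two starting points `x`, `y` there is a change of the initial velocity `u ↦ S u` under which
the Verlet trajectories started at `(x, u)` and `(y, S u)` meet at time `T`. It moves `u` by at most
`(3 / (2 T)) ‖x - y‖` and is almost volume preserving. -/
theorem exists_velocity_change (hf : PotentialAssumption f L M) (hd : 0 < d) (hh : 0 ≤ h)
    (hN : N * h = T) (hT : 0 < T) (hLT : L * T ^ 2 ≤ 1 / 12) (x y : EuclideanSpace ℝ (Fin d)) :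
    ∃ (S : EuclideanSpace ℝ (Fin d) → EuclideanSpace ℝ (Fin d))
      (S' : EuclideanSpace ℝ (Fin d) → EuclideanSpace ℝ (Fin d) →L[ℝ] EuclideanSpace ℝ (Fin d)),
      Function.Injective S ∧ (∀ u, HasFDerivAt S (S' u) u) ∧
      (∀ u, ((verletStep f h)^[N] (y, S u)).1 = ((verletStep f h)^[N] (x, u)).1) ∧
      (∀ u, ‖S u - u‖ ≤ 3 / (2 * T) * ‖x - y‖) ∧
      (∀ u, 1 ≤ Real.exp (8 * d * M * T ^ 2 * ‖x - y‖) * |(S' u).det|) := by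
  set Φ : EuclideanSpace ℝ (Fin d) → EuclideanSpace ℝ (Fin d) → EuclideanSpace ℝ (Fin d) :=
    fun z u => ((verletStep f h)^[N] (z, u)).1
  have hlin : ∀ z u w, ‖Φ z u - Φ z w - T • (u - w)‖ ≤ 1 / 23 * T * ‖u - w‖ := by
    intro z u w
    have := (norm_verlet_sub_le hf hh hN hLT (z, u) (z, w)).2
    simp only [sub_self, sub_zero, norm_zero, zero_add] at this
    linarith
  have hlow : ∀ z u w, 22 / 23 * T * ‖u - w‖ ≤ ‖Φ z u - Φ z w‖ := by
    intro z u w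
    have h1 := hlin z u w
    have h2 : ‖T • (u - w)‖ ≤ ‖Φ z u - Φ z w‖ + ‖Φ z u - Φ z w - T • (u - w)‖ := by
      have e : T • (u - w) = (Φ z u - Φ z w) - (Φ z u - Φ z w - T • (u - w)) := by abel
      calc ‖T • (u - w)‖ = ‖(Φ z u - Φ z w) - (Φ z u - Φ z w - T • (u - w))‖ := by rw [← e]
        _ ≤ _ := norm_sub_le _ _
    rw [norm_smul, Real.norm_of_nonneg hT.le] at h2
    linarith
  -- `Φ y / T` is a small Lipschitz perturbation of the identity, hence a homeomorphism
  have hsurj : ∃ Ψ : EuclideanSpace ℝ (Fin d) → EuclideanSpace ℝ (Fin d), ∀ z, Φ y (Ψ z) = z := by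
    have : Nonempty (Fin d) := ⟨⟨0, hd⟩⟩
    have happ : ApproximatesLinearOn (fun u => T⁻¹ • Φ y u)
        ((ContinuousLinearEquiv.refl ℝ (EuclideanSpace ℝ (Fin d)) :
          EuclideanSpace ℝ (Fin d) →L[ℝ] EuclideanSpace ℝ (Fin d))) univ (1 / 23) := by
      intro u _ w _
      have e : T⁻¹ • Φ y u - T⁻¹ • Φ y w
          - (ContinuousLinearEquiv.refl ℝ (EuclideanSpace ℝ (Fin d)) :
            EuclideanSpace ℝ (Fin d) →L[ℝ] EuclideanSpace ℝ (Fin d)) (u - w)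
          = T⁻¹ • (Φ y u - Φ y w - T • (u - w)) := by
        simp [smul_sub, smul_smul, inv_mul_cancel₀ hT.ne']
      rw [e, norm_smul, norm_inv, Real.norm_of_nonneg hT.le, inv_mul_le_iff₀ hT]
      have := hlin y u w
      simp only [NNReal.coe_div, NNReal.coe_one, NNReal.coe_ofNat]
      linarith
    have hs := happ.surjective (Or.inr (by
      have : ‖((ContinuousLinearEquiv.refl ℝ (EuclideanSpace ℝ (Fin d))).symm :
          EuclideanSpace ℝ (Fin d) →L[ℝ] EuclideanSpace ℝ (Fin d))‖₊ = 1 := by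
        apply NNReal.eq
        simp
      rw [this]
      apply NNReal.coe_lt_coe.1
      norm_num))
    choose g hg using hs
    refine ⟨fun z => g (T⁻¹ • z), fun z => ?_⟩
    have := hg (T⁻¹ • z)
    exact smul_right_injective _ (inv_ne_zero hT.ne') this
  obtain ⟨Ψ, hΨ⟩ := hsurj
  have hSeq : ∀ u, Φ y (Ψ (Φ x u)) = Φ x u := fun u => hΨ _
  have hclose : ∀ u, ‖Ψ (Φ x u) - u‖ ≤ 12 / 11 / T * ‖x - y‖ := by
    intro u
    have h1 := hlow y (Ψ (Φ x u)) u
    rw [hSeq] at h1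
    have h2 := (norm_verlet_sub_le hf hh hN hLT (x, u) (y, u)).1 N le_rfl
    simp only [sub_self, norm_zero, mul_zero, add_zero] at h2
    have h3 := h1.trans h2
    have h4 : T * ‖Ψ (Φ x u) - u‖ ≤ 12 / 11 * ‖x - y‖ := by linarith
    rw [div_mul_eq_mul_div, le_div_iff₀ hT]
    linarith
  have hder : ∀ z u, HasFDerivAt (Φ z) (verletTangent f h (z, u) N).1 u :=
    fun z u => (hasFDerivAt_verlet hf h z u N).1
  have hdet : ∀ u, (verletTangent f h (x, u) N).1.det ≠ 0 ∧
      |(verletTangent f h (y, Ψ (Φ x u)) N).1.det|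
        ≤ Real.exp (d * (8 * M * T ^ 2 * ‖x - y‖)) * |(verletTangent f h (x, u) N).1.det| := by
    intro u
    refine abs_det_le_exp_mul_abs_det hT (norm_verletTangent_le hf hh hN hLT _).2 ?_
    refine (norm_verletTangent_sub_le hf hh hN hLT _ _).trans ?_
    have h1 : T * ‖Ψ (Φ x u) - u‖ ≤ 12 / 11 * ‖x - y‖ := by
      have := mul_le_mul_of_nonneg_left (hclose u) hT.le
      calc _ ≤ _ := this
        _ = _ := by field_simp
    have h2 : ‖y - x‖ + T * ‖Ψ (Φ x u) - u‖ ≤ 23 / 11 * ‖x - y‖ := by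
      rw [norm_sub_rev y x]; linarith
    have hM := hf.nonneg_third
    calc (24 / 23 : ℝ) ^ 3 * (M * T ^ 3 / 2) * (‖y - x‖ + T * ‖Ψ (Φ x u) - u‖)
        ≤ (24 / 23 : ℝ) ^ 3 * (M * T ^ 3 / 2) * (23 / 11 * ‖x - y‖) := by gcongr
      _ = ((24 / 23 : ℝ) ^ 3 / 2 * (23 / 11)) * (M * T ^ 3 * ‖x - y‖) := by ring
      _ ≤ (22 / 23 * 8) * (M * T ^ 3 * ‖x - y‖) := by
          refine mul_le_mul_of_nonneg_right (by norm_num) (by positivity)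
      _ = _ := by ring
  have hdety : ∀ u, (verletTangent f h (y, u) N).1.det ≠ 0 := fun u =>
    (abs_det_le_exp_mul_abs_det (ε := 0) hT (norm_verletTangent_le hf hh hN hLT _).2
      (A' := (verletTangent f h (y, u) N).1) (by simp)).1
  have hΨcont : ∀ z, ContinuousAt Ψ z := by
    intro z
    have hlip : LipschitzWith (Real.toNNReal (23 / 22 / T)) Ψ := by
      refine LipschitzWith.of_dist_le_mul fun a b => ?_
      rw [dist_eq_norm, dist_eq_norm, Real.coe_toNNReal _ (by positivity)]
      have := hlow y (Ψ a) (Ψ b)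
      rw [hΨ, hΨ] at this
      rw [div_mul_eq_mul_div, le_div_iff₀ hT]
      linarith
    exact hlip.continuous.continuousAt
  have hSder : ∀ u, HasFDerivAt (fun u => Ψ (Φ x u))
      ((((verletTangent f h (y, Ψ (Φ x u)) N).1.toContinuousLinearEquivOfDetNeZero
        (hdety _)).symm : EuclideanSpace ℝ (Fin d) →L[ℝ] EuclideanSpace ℝ (Fin d)) ∘L
        (verletTangent f h (x, u) N).1) u := by
    intro u
    have h1 : HasFDerivAt Ψ ((((verletTangent f h
        (y, Ψ (Φ x u)) N).1.toContinuousLinearEquivOfDetNeZero (hdety _)).symm : EuclideanSpace ℝ (Fin d) →L[ℝ] EuclideanSpace ℝ (Fin d))) (Φ x u) :=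
      HasFDerivAt.of_local_left_inverse (hΨcont _) (by
        rw [ContinuousLinearMap.coe_toContinuousLinearEquivOfDetNeZero]
        exact hder y _) (Filter.Eventually.of_forall hΨ)
    exact h1.comp u (hder x u)
  refine ⟨fun u => Ψ (Φ x u), fun u => _, ?_, hSder, hSeq, fun u => ?_, fun u => ?_⟩
  · intro u w huw
    have h1 : Φ x u = Φ x w := by
      rw [← hSeq u, ← hSeq w]; exact congrArg (Φ y) huw
    have h2 := hlow x u w
    rw [h1, sub_self, norm_zero] at h2
    have h3 : 0 < 22 / 23 * T := by positivity
    exact sub_eq_zero.1 (norm_le_zero_iff.1 (by nlinarith [norm_nonneg (u - w)]))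
  · refine (hclose u).trans ?_
    gcongr ?_ * _
    rw [div_div, div_le_div_iff₀ (by positivity) (by positivity)]
    nlinarith
  · obtain ⟨h1, h2⟩ := hdet u
    set A := (verletTangent f h (x, u) N).1
    set A' := (verletTangent f h (y, Ψ (Φ x u)) N).1
    set e := A'.toContinuousLinearEquivOfDetNeZero (hdety _)
    have hcomp : A = A' ∘L
        ((e.symm : EuclideanSpace ℝ (Fin d) →L[ℝ] EuclideanSpace ℝ (Fin d)) ∘L A) := by
      ext1 v
      exact (e.apply_symm_apply (A v)).symm
    have hm : |A.det| = |A'.det| *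
        |((e.symm : EuclideanSpace ℝ (Fin d) →L[ℝ] EuclideanSpace ℝ (Fin d)) ∘L A).det| := by
      rw [← abs_mul]
      conv_lhs => rw [hcomp]
      congr 1
      exact LinearMap.det_comp _ _
    have hpos : 0 < |A'.det| := abs_pos.2 (hdety _)
    have hpos' : 0 < |A.det| := abs_pos.2 h1
    rw [hm] at h2
    have h3 : |A'.det| * 1 ≤ |A'.det| * (Real.exp (d * (8 * M * T ^ 2 * ‖x - y‖)) *
        |((e.symm : EuclideanSpace ℝ (Fin d) →L[ℝ] EuclideanSpace ℝ (Fin d)) ∘L A).det|) := by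
      linarith
    have h4 := le_of_mul_le_mul_left h3 hpos
    rwa [show (d : ℝ) * (8 * M * T ^ 2 * ‖x - y‖) = 8 * d * M * T ^ 2 * ‖x - y‖ by ring] at h4

end Verlet

/-! ### The exact Hamiltonian flow as a limit of Verlet flows -/

section Flow

variable {d : ℕ} {f : EuclideanSpace ℝ (Fin d) → ℝ} {L M h T : ℝ} {N : ℕ}

/-- Picard–Lindelöf on all of `[0, T]`. In the time unit `T` and with the rescaled velocity `2 T v`
the Hamiltonian vector field is `1 / 2`-Lipschitz, so that one large ball suffices. -/
theorem exists_isHamiltonianTrajectory (hf : PotentialAssumption f L M) (hT : 0 < T)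
    (hLT : L * T ^ 2 ≤ 1 / 12) (x₀ v₀ : EuclideanSpace ℝ (Fin d)) :
    ∃ γ : (ℝ → EuclideanSpace ℝ (Fin d)) × (ℝ → EuclideanSpace ℝ (Fin d)),
      IsHamiltonianTrajectory f T x₀ v₀ γ.1 γ.2 := by
  set F : EuclideanSpace ℝ (Fin d) × EuclideanSpace ℝ (Fin d) →
      EuclideanSpace ℝ (Fin d) × EuclideanSpace ℝ (Fin d) :=
    fun z => ((1 / 2 : ℝ) • z.2, -((2 * T ^ 2) • ∇ f z.1)) with hF
  have hlip : LipschitzWith (1 / 2) F := by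
    refine LipschitzWith.of_dist_le_mul fun z w => ?_
    rw [dist_eq_norm, dist_eq_norm, Prod.norm_def, Prod.norm_def]
    simp only [hF, Prod.fst_sub, Prod.snd_sub, NNReal.coe_div, NNReal.coe_one, NNReal.coe_ofNat]
    refine max_le ?_ ?_
    · rw [← smul_sub, norm_smul, Real.norm_of_nonneg (by norm_num)]
      gcongr
      exact le_max_right _ _
    · have e : -((2 * T ^ 2) • ∇ f z.1) - -((2 * T ^ 2) • ∇ f w.1)
          = (2 * T ^ 2) • (∇ f w.1 - ∇ f z.1) := by module
      rw [e, norm_smul, Real.norm_of_nonneg (by positivity)]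
      calc 2 * T ^ 2 * ‖∇ f w.1 - ∇ f z.1‖ ≤ 2 * T ^ 2 * (L * ‖w.1 - z.1‖) := by
            gcongr; exact hf.norm_gradient_sub_le _ _
        _ = 2 * (L * T ^ 2) * ‖z.1 - w.1‖ := by rw [norm_sub_rev]; ring
        _ ≤ 1 / 2 * ‖z.1 - w.1‖ := by gcongr; linarith
        _ ≤ _ := by gcongr; exact le_max_left _ _
  set z₀ : EuclideanSpace ℝ (Fin d) × EuclideanSpace ℝ (Fin d) := (x₀, (2 * T) • v₀) with hz₀
  have hPL : IsPicardLindelof (fun _ => F) (⟨0, by simp⟩ : Icc (0 : ℝ) 1) z₀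
      (2 * ‖F z₀‖₊) 0 (2 * ‖F z₀‖₊) (1 / 2) := by
    refine IsPicardLindelof.of_time_independent ?_ hlip.lipschitzOnWith (by simp)
    intro z hz
    have h1 : ‖F z - F z₀‖ ≤ 1 / 2 * ‖z - z₀‖ := by
      have := hlip.dist_le_mul z z₀
      simpa [dist_eq_norm] using this
    have h2 : ‖z - z₀‖ ≤ 2 * ‖F z₀‖ := by simpa [dist_eq_norm] using hz
    have h3 : ‖F z‖ ≤ ‖F z - F z₀‖ + ‖F z₀‖ := by
      simpa using norm_add_le (F z - F z₀) (F z₀)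
    simp only [NNReal.coe_mul, NNReal.coe_ofNat, coe_nnnorm]
    linarith
  obtain ⟨α, hα0, hα⟩ := hPL.exists_eq_forall_mem_Icc_hasDerivWithinAt₀
  have hα0' : α 0 = z₀ := hα0
  have hmaps : MapsTo (fun t : ℝ => t / T) (Icc 0 T) (Icc 0 1) := fun t ht =>
    ⟨div_nonneg ht.1 hT.le, (div_le_one hT).2 ht.2⟩
  refine ⟨(fun t => (α (t / T)).1, fun t => (2 * T)⁻¹ • (α (t / T)).2), ?_, ?_, fun t ht => ?_⟩
  · simp [hα0', hz₀]
  · simp only [zero_div, hα0', hz₀]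
    rw [inv_smul_smul₀ (by positivity)]
  · have h1 : HasDerivWithinAt (fun t => α (t / T)) (T⁻¹ • F (α (t / T))) (Icc 0 T) t := by
      have hd : HasDerivWithinAt (fun t : ℝ => t / T) T⁻¹ (Icc 0 T) t := by
        simpa [div_eq_mul_inv] using ((hasDerivAt_id t).mul_const T⁻¹).hasDerivWithinAt
      exact HasDerivWithinAt.scomp t (hα _ (hmaps ht)) hd hmaps
    have hx : HasDerivWithinAt (fun t => (α (t / T)).1) (T⁻¹ • F (α (t / T))).1 (Icc 0 T) t :=
      (ContinuousLinearMap.fst ℝ (EuclideanSpace ℝ (Fin d))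
        (EuclideanSpace ℝ (Fin d))).hasFDerivAt.comp_hasDerivWithinAt t h1
    have hv : HasDerivWithinAt (fun t => (α (t / T)).2) (T⁻¹ • F (α (t / T))).2 (Icc 0 T) t :=
      (ContinuousLinearMap.snd ℝ (EuclideanSpace ℝ (Fin d))
        (EuclideanSpace ℝ (Fin d))).hasFDerivAt.comp_hasDerivWithinAt t h1
    constructor
    · refine hx.congr_deriv ?_
      simp only [hF, Prod.smul_fst, smul_smul]
      congr 1
      field_simp
    · refine (hv.const_smul ((2 * T)⁻¹)).congr_deriv ?_
      simp only [hF, Prod.smul_snd, smul_smul, smul_neg]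
      rw [show (2 * T)⁻¹ * (T⁻¹ * (2 * T ^ 2)) = 1 by field_simp, one_smul]

/-- Taylor expansion of a Hamiltonian trajectory over a time step. -/
theorem IsHamiltonianTrajectory.local_error (hf : PotentialAssumption f L M)
    {x₀ v₀ : EuclideanSpace ℝ (Fin d)} {x v : ℝ → EuclideanSpace ℝ (Fin d)}
    (hxv : IsHamiltonianTrajectory f T x₀ v₀ x v) {V : ℝ} (hV : ∀ t ∈ Icc 0 T, ‖v t‖ ≤ V)
    {t : ℝ} (ht : 0 ≤ t) (hh : 0 ≤ h) (hth : t + h ≤ T) :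
    ‖x (t + h) - x t‖ ≤ V * h ∧
    ‖v (t + h) - v t + h • ∇ f (x t)‖ ≤ L * V * h * h ∧
    ‖x (t + h) - x t - h • v t + (h ^ 2 / 2) • ∇ f (x t)‖ ≤ L * V * h * h ^ 2 / 2 := by
  have hsub : Icc t (t + h) ⊆ Icc 0 T := Icc_subset_Icc ht hth
  have hxc : ContinuousOn x (Icc t (t + h)) := fun s hs =>
    ((hxv.2.2 s (hsub hs)).1.continuousWithinAt).mono hsub
  have hvc : ContinuousOn v (Icc t (t + h)) := fun s hs =>
    ((hxv.2.2 s (hsub hs)).2.continuousWithinAt).mono hsub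
  have hmem : ∀ s ∈ Ico t (t + h), s ∈ Icc 0 T := fun s hs => hsub (Ico_subset_Icc_self hs)
  have hnhds : ∀ s ∈ Ico t (t + h), Icc 0 T ∈ nhdsWithin s (Ici s) := fun s hs =>
    Filter.mem_of_superset (Icc_mem_nhdsGE (hs.2.trans_le hth))
      (Icc_subset_Icc_left (hmem s hs).1)
  have hx' : ∀ s ∈ Ico t (t + h), HasDerivWithinAt x (v s) (Ici s) s := fun s hs =>
    (hxv.2.2 s (hmem s hs)).1.mono_of_mem_nhdsWithin (hnhds s hs)
  have hv' : ∀ s ∈ Ico t (t + h), HasDerivWithinAt v (-∇ f (x s)) (Ici s) s := fun s hs =>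
    (hxv.2.2 s (hmem s hs)).2.mono_of_mem_nhdsWithin (hnhds s hs)
  have hV0 : 0 ≤ V := (norm_nonneg _).trans (hV t (hsub ⟨le_rfl, by linarith⟩))
  have hL := hf.nonneg_hess
  have hx1 : ∀ s ∈ Icc t (t + h), ‖x s - x t‖ ≤ V * (s - t) :=
    norm_image_sub_le_of_norm_deriv_right_le_segment hxc hx' fun s hs => hV s (hmem s hs)
  have hlin : ∀ s : ℝ, HasDerivAt (fun s => s - t) 1 s := fun s => (hasDerivAt_id s).sub_const t
  have hquad : ∀ s : ℝ, HasDerivAt (fun s => (s - t) ^ 2 / 2) (s - t) s := fun s => by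
    refine (((hlin s).fun_pow 2).div_const 2).congr_deriv ?_
    norm_num
  have hv1 : ∀ s ∈ Icc t (t + h), ‖v s - v t + (s - t) • ∇ f (x t)‖ ≤ L * V * h * (s - t) := by
    refine image_norm_le_of_norm_deriv_right_le_deriv_boundary
      (f' := fun s => -∇ f (x s) + (1 : ℝ) • ∇ f (x t)) (B' := fun _ => L * V * h)
      (by fun_prop) (fun s hs => ?_) (by simp) (fun s => ?_) (fun s hs => ?_)
    · exact ((hv' s hs).sub_const _).add ((hlin s).hasDerivWithinAt.smul_const _)
    · simpa using (hlin s).const_mul (L * V * h)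
    · have h1 := hf.norm_gradient_sub_le (x t) (x s)
      have h2 := hx1 s (Ico_subset_Icc_self hs)
      rw [one_smul, neg_add_eq_sub]
      calc _ ≤ L * ‖x t - x s‖ := h1
        _ ≤ L * (V * h) := by
          rw [norm_sub_rev]
          gcongr
          exact h2.trans (by gcongr; linarith [hs.2])
        _ = _ := by ring
  have hx2 : ∀ s ∈ Icc t (t + h), ‖x s - x t - (s - t) • v t + ((s - t) ^ 2 / 2) • ∇ f (x t)‖
      ≤ L * V * h * ((s - t) ^ 2 / 2) := by
    refine image_norm_le_of_norm_deriv_right_le_deriv_boundary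
      (f' := fun s => v s - (1 : ℝ) • v t + (s - t) • ∇ f (x t))
      (B' := fun s => L * V * h * (s - t))
      (by fun_prop) (fun s hs => ?_) (by simp) (fun s => ?_) (fun s hs => ?_)
    · exact (((hx' s hs).sub_const _).sub ((hlin s).hasDerivWithinAt.smul_const _)).add
        ((hquad s).hasDerivWithinAt.smul_const _)
    · exact (hquad s).const_mul (L * V * h)
    · rw [one_smul]
      exact hv1 s (Ico_subset_Icc_self hs)
  have hend : t + h ∈ Icc t (t + h) := ⟨by linarith, le_rfl⟩
  have e : t + h - t = h := by ring
  refine ⟨?_, ?_, ?_⟩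
  · simpa [e] using hx1 _ hend
  · simpa [e] using hv1 _ hend
  · simpa [e, mul_div_assoc] using hx2 _ hend

/-- Global error of the Verlet integrator. -/
theorem IsHamiltonianTrajectory.norm_verlet_sub_le (hf : PotentialAssumption f L M)
    {x₀ v₀ : EuclideanSpace ℝ (Fin d)} {x v : ℝ → EuclideanSpace ℝ (Fin d)}
    (hxv : IsHamiltonianTrajectory f T x₀ v₀ x v) {V : ℝ} (hV : ∀ t ∈ Icc 0 T, ‖v t‖ ≤ V)
    (hV0 : 0 ≤ V) (hh : 0 ≤ h) (hN : N * h = T) (hLT : L * T ^ 2 ≤ 1 / 12) :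
    ‖((verletStep f h)^[N] (x₀, v₀)).1 - x T‖ ≤ 24 / 23 * (L * V * T ^ 2) * h := by
  have hL := hf.nonneg_hess
  set X : ℕ → EuclideanSpace ℝ (Fin d) := fun j => ((verletStep f h)^[j] (x₀, v₀)).1 with hX
  set W : ℕ → EuclideanSpace ℝ (Fin d) := fun j => ((verletStep f h)^[j] (x₀, v₀)).2 with hW
  have htime : ∀ j < N, (j : ℝ) * h + h ≤ T := by
    intro j hj
    rw [← hN]
    have : (j : ℝ) + 1 ≤ N := by exact_mod_cast hj
    nlinarith
  have hloc := fun j (hj : j < N) =>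
    hxv.local_error hf hV (by positivity : 0 ≤ (j : ℝ) * h) hh (htime j hj)
  have hcast : ∀ j : ℕ, ((j + 1 : ℕ) : ℝ) * h = j * h + h := fun j => by push_cast; ring
  obtain ⟨h1, -⟩ := norm_le_of_perturbed_recursion (V := EuclideanSpace ℝ (Fin d))
    (a := fun j => X j - x (j * h)) (b := fun j => W j - v (j * h))
    (A := fun j => (h ^ 2 / 2) • (∇ f (X j) - ∇ f (x (j * h)))
      + (x (j * h + h) - x (j * h) - h • v (j * h) + (h ^ 2 / 2) • ∇ f (x (j * h))))
    (B := fun j => (h / 2) • ((∇ f (X j) - ∇ f (x (j * h)))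
        + (∇ f (X (j + 1)) - ∇ f (x (j * h + h))))
      + ((v (j * h + h) - v (j * h) + h • ∇ f (x (j * h)))
        + (h / 2) • (∇ f (x (j * h + h)) - ∇ f (x (j * h)))))
    (K := 2 * (L * V * h)) hh hN hL (by positivity) hLT
    (fun j _ => by
      simp only [hX, hW, verletStep_iterate_succ_fst, hcast]; module)
    (fun j _ => by
      simp only [hX, hW, verletStep_iterate_succ_snd f h (x₀, v₀) j, hcast]; module)
    (fun Z hZ j hj => by
      obtain ⟨-, -, l3⟩ := hloc j hj
      have g1 := (hf.norm_gradient_sub_le (X j) (x (j * h))).trans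
        (mul_le_mul_of_nonneg_left (hZ j hj.le) hL)
      refine (norm_add_le _ _).trans ?_
      rw [norm_smul, Real.norm_of_nonneg (by positivity)]
      have := mul_le_mul_of_nonneg_left g1 (by positivity : 0 ≤ h ^ 2 / 2)
      have h0 : 0 ≤ L * V * h * h ^ 2 := by positivity
      nlinarith)
    (fun Z hZ j hj => by
      obtain ⟨l1, l2, -⟩ := hloc j hj
      have g1 := (hf.norm_gradient_sub_le (X j) (x (j * h))).trans
        (mul_le_mul_of_nonneg_left (hZ j hj.le) hL)
      have g2 := (hf.norm_gradient_sub_le (X (j + 1)) (x (j * h + h))).trans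
        (mul_le_mul_of_nonneg_left (by simpa only [hcast] using hZ (j + 1) hj) hL)
      have g3 := (hf.norm_gradient_sub_le (x (j * h + h)) (x (j * h))).trans
        (mul_le_mul_of_nonneg_left l1 hL)
      refine (norm_add_le _ _).trans ?_
      rw [norm_smul, Real.norm_of_nonneg (by positivity)]
      have t1 := mul_le_mul_of_nonneg_left ((norm_add_le _ _).trans (add_le_add g1 g2))
        (by positivity : 0 ≤ h / 2)
      have t2 : ‖(v (j * h + h) - v (j * h) + h • ∇ f (x (j * h)))
          + (h / 2) • (∇ f (x (j * h + h)) - ∇ f (x (j * h)))‖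
          ≤ L * V * h * h + h / 2 * (L * (V * h)) := by
        refine (norm_add_le _ _).trans (add_le_add l2 ?_)
        rw [norm_smul, Real.norm_of_nonneg (by positivity)]
        gcongr
      have h0 : 0 ≤ L * V * h * h := by positivity
      nlinarith)
  have h2 := h1 N le_rfl
  simp only [hX, hW, hN, Nat.cast_zero, zero_mul, hxv.1, hxv.2.1, Function.iterate_zero, id,
    sub_self, norm_zero, mul_zero, zero_add] at h2
  refine h2.trans (le_of_eq ?_)
  ring

/-- The exact flow map is the pointwise limit of the Verlet flow maps with step sizes `T / n`. -/
theorem tendsto_verlet_hamiltonianFlow (hf : PotentialAssumption f L M) (hT : 0 < T)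
    (hLT : L * T ^ 2 ≤ 1 / 12) (p : EuclideanSpace ℝ (Fin d) × EuclideanSpace ℝ (Fin d)) :
    Filter.Tendsto (fun n : ℕ => ((verletStep f (T / (n + 1 : ℕ)))^[n + 1] p).1) Filter.atTop
      (nhds (hamiltonianFlow f T p).1) := by
  have H := exists_isHamiltonianTrajectory hf hT hLT p.1 p.2
  have hflow : (hamiltonianFlow f T p).1 = H.choose.1 T := by
    rw [hamiltonianFlow, dif_pos H]
  have hsp := H.choose_spec
  set x := H.choose.1
  set v := H.choose.2
  obtain ⟨V, hV⟩ := isCompact_Icc.exists_bound_of_continuousOn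
    (fun t ht => (hsp.2.2 t ht).2.continuousWithinAt : ContinuousOn v (Icc 0 T))
  have hV0 : 0 ≤ V := (norm_nonneg _).trans (hV 0 ⟨le_rfl, hT.le⟩)
  rw [hflow, tendsto_iff_norm_sub_tendsto_zero]
  have hlim : Filter.Tendsto
      (fun n : ℕ => 24 / 23 * (L * V * T ^ 2) * (T / (n + 1 : ℕ))) Filter.atTop (nhds 0) := by
    have h1 := (tendsto_const_div_atTop_nhds_zero_nat T).comp (Filter.tendsto_add_atTop_nat 1)
    simpa using h1.const_mul (24 / 23 * (L * V * T ^ 2))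
  refine squeeze_zero (fun _ => norm_nonneg _) (fun n => ?_) hlim
  exact hsp.norm_verlet_sub_le hf hV hV0 (by positivity)
    (by field_simp) hLT

/-- At time `T`, every uHMC-v position map is a pointwise limit of Verlet position maps satisfying
the same step-size-free condition `L T² ≤ 1 / 12`. -/
theorem exists_tendsto_uhmcPosition (hf : PotentialAssumption f L M) (hT : 0 < T) (hh : 0 ≤ h)
    (hdvd : 0 < h → ∃ N : ℕ, T = N * h) (hLT : L * T ^ 2 ≤ 1 / 12) :
    ∃ (s : ℕ → ℝ) (n : ℕ → ℕ), (∀ i, 0 ≤ s i) ∧ (∀ i, n i * s i = T) ∧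
      ∀ p, Filter.Tendsto (fun i => ((verletStep f (s i))^[n i] p).1) Filter.atTop
        (nhds (uhmcPosition f T h p)) := by
  rcases hh.eq_or_lt with rfl | hpos
  · refine ⟨fun i => T / (i + 1 : ℕ), fun i => i + 1, fun i => by positivity,
      fun i => by field_simp, fun p => ?_⟩
    simpa [uhmcPosition] using tendsto_verlet_hamiltonianFlow hf hT hLT p
  · obtain ⟨N, hN⟩ := hdvd hpos
    refine ⟨fun _ => h, fun _ => N, fun _ => hh, fun _ => hN.symm, fun p => ?_⟩
    have : ⌊T / h⌋₊ = N := by rw [hN, mul_div_cancel_right₀ _ hpos.ne', Nat.floor_natCast]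
    rw [uhmcPosition, if_neg hpos.ne', verletFlow, this]
    exact tendsto_const_nhds

theorem measurable_uhmcPosition (hf : PotentialAssumption f L M) (hT : 0 < T) (hh : 0 ≤ h)
    (hdvd : 0 < h → ∃ N : ℕ, T = N * h) (hLT : L * T ^ 2 ≤ 1 / 12) :
    Measurable (uhmcPosition f T h) := by
  obtain ⟨s, n, -, -, hlim⟩ := exists_tendsto_uhmcPosition hf hT hh hdvd hLT
  refine measurable_of_tendsto_metrizable (fun i => ?_) (tendsto_pi_nhds.2 hlim)
  exact (continuous_fst.comp ((continuous_verletStep hf (s i)).iterate (n i))).measurable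

end Flow

/-! ### Density and exponential moments of the standard Gaussian measure -/

section Gaussian

variable {d : ℕ}

/-- The density of the standard Gaussian measure on `ℝ^d`. -/
def stdGaussianDensity (x : EuclideanSpace ℝ (Fin d)) : ℝ :=
  (2 * Real.pi) ^ (-(d : ℝ) / 2) * Real.exp (-‖x‖ ^ 2 / 2)

theorem stdGaussianDensity_pos (x : EuclideanSpace ℝ (Fin d)) : 0 < stdGaussianDensity x := by
  unfold stdGaussianDensity; positivity

theorem continuous_stdGaussianDensity :
    Continuous (stdGaussianDensity : EuclideanSpace ℝ (Fin d) → ℝ) := by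
  unfold stdGaussianDensity; fun_prop

theorem lintegral_exp_neg_mul_norm_sq {b : ℝ} (hb : 0 < b) :
    ∫⁻ x : EuclideanSpace ℝ (Fin d), ENNReal.ofReal (Real.exp (-b * ‖x‖ ^ 2))
      = ENNReal.ofReal ((Real.pi / b) ^ ((d : ℝ) / 2)) := by
  have h := GaussianFourier.integral_rexp_neg_mul_sq_norm (V := EuclideanSpace ℝ (Fin d)) hb
  rw [finrank_euclideanSpace_fin] at h
  have hne : ∫ x : EuclideanSpace ℝ (Fin d), Real.exp (-b * ‖x‖ ^ 2) ≠ 0 := by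
    rw [h]; positivity
  rw [← h, ofReal_integral_eq_lintegral_ofReal (Integrable.of_integral_ne_zero hne)
    (Filter.Eventually.of_forall fun x => (Real.exp_pos _).le)]

theorem lintegral_exp_mul_stdGaussianDensity {c : ℝ} (hc : c < 1 / 2) :
    ∫⁻ x : EuclideanSpace ℝ (Fin d),
        ENNReal.ofReal (stdGaussianDensity x) * ENNReal.ofReal (Real.exp (c * ‖x‖ ^ 2))
      = ENNReal.ofReal ((1 - 2 * c) ^ (-(d : ℝ) / 2)) := by
  have hpi := Real.pi_pos
  have h1 : ∀ x : EuclideanSpace ℝ (Fin d),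
      ENNReal.ofReal (stdGaussianDensity x) * ENNReal.ofReal (Real.exp (c * ‖x‖ ^ 2))
      = ENNReal.ofReal ((2 * Real.pi) ^ (-(d : ℝ) / 2))
        * ENNReal.ofReal (Real.exp (-(1 / 2 - c) * ‖x‖ ^ 2)) := by
    intro x
    rw [← ENNReal.ofReal_mul (stdGaussianDensity_pos x).le, ← ENNReal.ofReal_mul (by positivity),
      stdGaussianDensity, mul_assoc, ← Real.exp_add]
    ring_nf
  simp_rw [h1]
  rw [lintegral_const_mul _ (by fun_prop), lintegral_exp_neg_mul_norm_sq (by linarith),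
    ← ENNReal.ofReal_mul (by positivity)]
  congr 1
  have hc' : 0 < 1 - 2 * c := by linarith
  rw [show Real.pi / (1 / 2 - c) = (2 * Real.pi) * (1 - 2 * c)⁻¹ by
      rw [show (1 / 2 - c) = (1 - 2 * c) / 2 by ring]; field_simp,
    Real.mul_rpow (x := 2 * Real.pi) (by positivity) (by positivity), ← mul_assoc, ← Real.rpow_add (by positivity),
    Real.inv_rpow hc'.le, ← Real.rpow_neg hc'.le]
  rw [show -(d : ℝ) / 2 + d / 2 = 0 by ring, Real.rpow_zero, one_mul]
  congr 1
  ring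

theorem stdGaussian_eq_withDensity :
    stdGaussian (EuclideanSpace ℝ (Fin d))
      = volume.withDensity fun x => ENNReal.ofReal (stdGaussianDensity x) := by
  have hpi := Real.pi_pos
  have hm : Measurable fun x : EuclideanSpace ℝ (Fin d) => ENNReal.ofReal (stdGaussianDensity x) :=
    continuous_stdGaussianDensity.measurable.ennreal_ofReal
  have hprob : IsFiniteMeasure (volume.withDensity fun x : EuclideanSpace ℝ (Fin d) =>
      ENNReal.ofReal (stdGaussianDensity x)) := by
    refine isFiniteMeasure_withDensity ?_
    have := lintegral_exp_mul_stdGaussianDensity (d := d) (c := 0) (by norm_num)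
    simp only [zero_mul, Real.exp_zero, ENNReal.ofReal_one, mul_one] at this
    rw [this]
    exact ENNReal.ofReal_ne_top
  refine Measure.ext_of_charFun (funext fun t => ?_)
  rw [charFun_stdGaussian, charFun_apply, integral_withDensity_eq_integral_toReal_smul hm
    (Filter.Eventually.of_forall fun x => ENNReal.ofReal_lt_top)]
  have h1 : ∀ x : EuclideanSpace ℝ (Fin d),
      (ENNReal.ofReal (stdGaussianDensity x)).toReal • Complex.exp (inner ℝ x t * Complex.I)
      = ((2 * Real.pi : ℝ) : ℂ) ^ (-(d : ℂ) / 2)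
        * Complex.exp (-(1 / 2 : ℂ) * ‖x‖ ^ 2 + Complex.I * inner ℝ t x) := by
    intro x
    rw [ENNReal.toReal_ofReal (stdGaussianDensity_pos x).le, stdGaussianDensity, Complex.real_smul,
      Complex.ofReal_mul, Complex.ofReal_cpow (by positivity), mul_assoc, Complex.ofReal_exp,
      ← Complex.exp_add, real_inner_comm]
    push_cast
    ring_nf
  simp_rw [h1]
  rw [integral_const_mul, GaussianFourier.integral_cexp_neg_mul_sq_norm_add (by norm_num),
    finrank_euclideanSpace_fin, ← mul_assoc]
  have h2 : ((Real.pi : ℂ) / (1 / 2)) = ((2 * Real.pi : ℝ) : ℂ) := by push_cast; ring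
  rw [h2, ← Complex.cpow_add _ _ (by exact_mod_cast (by positivity : (2 * Real.pi : ℝ) ≠ 0))]
  rw [show -(d : ℂ) / 2 + d / 2 = 0 by ring, Complex.cpow_zero, one_mul, Complex.I_sq]
  congr 1
  ring

theorem lintegral_stdGaussian {g : EuclideanSpace ℝ (Fin d) → ℝ≥0∞} (hg : Measurable g) :
    ∫⁻ x, g x ∂(stdGaussian (EuclideanSpace ℝ (Fin d)))
      = ∫⁻ x, ENNReal.ofReal (stdGaussianDensity x) * g x := by
  rw [stdGaussian_eq_withDensity,
    lintegral_withDensity_eq_lintegral_mul _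
      continuous_stdGaussianDensity.measurable.ennreal_ofReal hg]
  rfl

theorem log_le_half_sub_inv {β : ℝ} (hβ : 1 ≤ β) : Real.log β ≤ (β - β⁻¹) / 2 := by
  have h := Real.self_le_sinh_iff.2 (Real.log_nonneg hβ)
  rwa [Real.sinh_eq, Real.exp_neg, Real.exp_log (by linarith)] at h

/-- Concentration of the Gaussian norm. From `a ‖x‖ ≤ (a / 2) (b + ‖x‖² / b)` and the exponential
moments of `‖x‖²`; the optimal `b = √d β` solves `b² - a b = d`. -/
theorem lintegral_exp_norm_stdGaussian_le (hd : 0 < d) {a : ℝ} (ha : 0 ≤ a) :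
    ∫⁻ x, ENNReal.ofReal (Real.exp (a * ‖x‖)) ∂(stdGaussian (EuclideanSpace ℝ (Fin d)))
      ≤ ENNReal.ofReal (Real.exp (a * √(d : ℝ) + a ^ 2 / 2)) := by
  have hd' : (0 : ℝ) < d := by exact_mod_cast hd
  set s := √(d : ℝ) with hs
  have hs0 : 0 < s := Real.sqrt_pos.2 hd'
  have hs2 : s ^ 2 = d := Real.sq_sqrt hd'.le
  set β := (a / s + √((a / s) ^ 2 + 4)) / 2 with hβdef
  have hsq : √((a / s) ^ 2 + 4) ^ 2 = (a / s) ^ 2 + 4 := Real.sq_sqrt (by positivity)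
  have has : 0 ≤ a / s := by positivity
  have hβ1 : 1 ≤ β := by
    have : 2 ≤ √((a / s) ^ 2 + 4) := Real.le_sqrt_of_sq_le (by nlinarith [sq_nonneg (a / s)])
    rw [hβdef]; linarith
  have hβ0 : 0 < β := by linarith
  have hβeq : β ^ 2 = a / s * β + 1 := by
    rw [hβdef]; nlinarith
  have haβ : a = s * (β - β⁻¹) := by
    have : β - β⁻¹ = a / s := by
      field_simp
      field_simp at hβeq
      linarith
    rw [this]; field_simp
  set c := a / (2 * (s * β)) with hc
  have h2c : 1 - 2 * c = (β ^ 2)⁻¹ := by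
    rw [hc, haβ]; field_simp; ring
  have hc12 : c < 1 / 2 := by
    have : 0 < (β ^ 2)⁻¹ := by positivity
    linarith
  have hpt : ∀ x : EuclideanSpace ℝ (Fin d), ENNReal.ofReal (Real.exp (a * ‖x‖))
      ≤ ENNReal.ofReal (Real.exp (a * (s * β) / 2))
        * ENNReal.ofReal (Real.exp (c * ‖x‖ ^ 2)) := by
    intro x
    rw [← ENNReal.ofReal_mul (Real.exp_pos _).le, ← Real.exp_add]
    refine ENNReal.ofReal_le_ofReal (Real.exp_le_exp.2 ?_)
    have e : a * (s * β) / 2 + c * ‖x‖ ^ 2 - a * ‖x‖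
        = a / (2 * (s * β)) * (s * β - ‖x‖) ^ 2 := by
      rw [hc]; field_simp; ring
    have : 0 ≤ a / (2 * (s * β)) * (s * β - ‖x‖) ^ 2 := by positivity
    linarith
  refine (lintegral_mono hpt).trans ?_
  rw [lintegral_const_mul _ (by fun_prop), lintegral_stdGaussian (by fun_prop),
    lintegral_exp_mul_stdGaussianDensity hc12, ← ENNReal.ofReal_mul (Real.exp_pos _).le]
  refine ENNReal.ofReal_le_ofReal ?_
  have hpow : (1 - 2 * c) ^ (-(d : ℝ) / 2) = Real.exp (d * Real.log β) := by
    rw [h2c, Real.rpow_def_of_pos (by positivity), Real.log_inv, Real.log_pow]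
    congr 1
    push_cast
    ring
  rw [hpow, ← Real.exp_add]
  refine Real.exp_le_exp.2 ?_
  have hlog : Real.log β ≤ β - β⁻¹ - 1 / 2 + (β⁻¹) ^ 2 / 2 := by
    refine (log_le_half_sub_inv hβ1).trans ?_
    have e : β - β⁻¹ - 1 / 2 + (β⁻¹) ^ 2 / 2 - (β - β⁻¹) / 2
        = (β - 1) ^ 2 * (β + 1) / (2 * β ^ 2) := by
      field_simp; ring
    have : 0 ≤ (β - 1) ^ 2 * (β + 1) / (2 * β ^ 2) := by positivity
    linarith
  have h1 : (d : ℝ) * Real.log β ≤ d * (β - β⁻¹ - 1 / 2 + (β⁻¹) ^ 2 / 2) := by gcongr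
  have h2 : a * (s * β) / 2 = d * (β ^ 2 - 1) / 2 := by
    rw [haβ, ← hs2]; field_simp
  have h3 : a * s + a ^ 2 / 2 = d * (β - β⁻¹) + d * (β ^ 2 - 2 + (β⁻¹) ^ 2) / 2 := by
    rw [haβ, ← hs2]; field_simp; ring
  rw [h2, h3]
  linarith

end Gaussian

/-! ### Harnack inequality for one uHMC-v transition -/

section Harnack

variable {d : ℕ} {f : EuclideanSpace ℝ (Fin d) → ℝ} {L M h T q : ℝ} {N : ℕ}

/-- Change of measure for a Gaussian vector: if `S` moves points by at most `e` and does not contract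
volume by more than `exp(-A)`, then `N(0, I)`-averages of `φ ∘ S` are controlled by those of
`φ ^ (q / (q - 1))`. -/
theorem lintegral_stdGaussian_comp_le (hd : 0 < d) (hq : 1 < q) {A e : ℝ} (he : 0 ≤ e)
    {S : EuclideanSpace ℝ (Fin d) → EuclideanSpace ℝ (Fin d)}
    {S' : EuclideanSpace ℝ (Fin d) → EuclideanSpace ℝ (Fin d) →L[ℝ] EuclideanSpace ℝ (Fin d)}
    (hS : Function.Injective S) (hS' : ∀ u, HasFDerivAt S (S' u) u) (hSe : ∀ u, ‖S u - u‖ ≤ e)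
    (hdet : ∀ u, 1 ≤ Real.exp A * |(S' u).det|)
    {φ : EuclideanSpace ℝ (Fin d) → ℝ≥0∞} (hφ : Measurable φ) :
    ∫⁻ u, φ (S u) ∂(stdGaussian (EuclideanSpace ℝ (Fin d)))
      ≤ ENNReal.ofReal (Real.exp ((q - 1) * A + (q - 1) * e * √(d : ℝ)
          + q * (q - 1) * e ^ 2 / 2)) ^ (1 / q)
        * (∫⁻ w, φ w ^ (q / (q - 1)) ∂(stdGaussian (EuclideanSpace ℝ (Fin d)))) ^ ((q - 1) / q) := by
  have hq0 : 0 < q := by linarith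
  have hq1 : 0 < q - 1 := by linarith
  have hconj : (q / (q - 1)).HolderConjugate q := by
    rw [Real.holderConjugate_comm, Real.holderConjugate_iff]
    refine ⟨hq, ?_⟩
    field_simp
    ring
  have hScont : Continuous S :=
    continuous_iff_continuousAt.2 fun u => (hS' u).continuousAt
  have hρ : Measurable fun x : EuclideanSpace ℝ (Fin d) => ENNReal.ofReal (stdGaussianDensity x) :=
    continuous_stdGaussianDensity.measurable.ennreal_ofReal
  have hDmeas : Measurable fun u => ENNReal.ofReal |(S' u).det| := by
    have hfd : S' = fderiv ℝ S := funext fun u => (hS' u).fderiv.symm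
    have h1 : Measurable fun u => (fderiv ℝ S u).det :=
      ContinuousLinearMap.continuous_det.measurable.comp (measurable_fderiv ℝ S)
    rw [hfd]
    exact (continuous_abs.measurable.comp h1).ennreal_ofReal
  set ρ : EuclideanSpace ℝ (Fin d) → ℝ≥0∞ := fun x => ENNReal.ofReal (stdGaussianDensity x) with hρd
  -- `κ J` dominates the Gaussian density, `J` being the density transported back along `S`
  set J : EuclideanSpace ℝ (Fin d) → ℝ≥0∞ := fun u => ENNReal.ofReal |(S' u).det| * ρ (S u) with hJ
  set κ : EuclideanSpace ℝ (Fin d) → ℝ≥0∞ := fun u =>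
    ENNReal.ofReal (Real.exp (A + e ^ 2 / 2 + e * ‖u‖)) with hκ
  have hJm : Measurable J := hDmeas.mul (hρ.comp hScont.measurable)
  have hκm : Measurable κ := by rw [hκ]; fun_prop
  have hdom : ∀ u, ρ u ≤ κ u * J u := by
    intro u
    simp only [hρd, hκ, hJ]
    rw [← ENNReal.ofReal_mul (abs_nonneg _), ← ENNReal.ofReal_mul (Real.exp_pos _).le]
    refine ENNReal.ofReal_le_ofReal ?_
    have hnorm : ‖S u‖ ≤ ‖u‖ + e := by
      have : S u = u + (S u - u) := by abel
      calc ‖S u‖ = ‖u + (S u - u)‖ := by rw [← this]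
        _ ≤ ‖u‖ + e := (norm_add_le _ _).trans (add_le_add le_rfl (hSe u))
    have hdens : stdGaussianDensity u
        ≤ Real.exp (e ^ 2 / 2 + e * ‖u‖) * stdGaussianDensity (S u) := by
      unfold stdGaussianDensity
      rw [mul_left_comm, ← Real.exp_add]
      gcongr
      nlinarith [norm_nonneg (S u), norm_nonneg u]
    calc stdGaussianDensity u
        ≤ (Real.exp A * |(S' u).det|) *
            (Real.exp (e ^ 2 / 2 + e * ‖u‖) * stdGaussianDensity (S u)) := by
          refine hdens.trans (le_mul_of_one_le_left ?_ (hdet u))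
          exact mul_nonneg (Real.exp_pos _).le (stdGaussianDensity_pos _).le
      _ = _ := by rw [show A + e ^ 2 / 2 + e * ‖u‖ = A + (e ^ 2 / 2 + e * ‖u‖) by ring,
                    Real.exp_add A]; ring
  have hr : 0 ≤ (q - 1) / q := by positivity
  have hr1 : (q - 1) / q + 1 / q = 1 := by field_simp; ring
  have hsplit : ∀ u, ρ u * φ (S u)
      ≤ ((fun u => J u ^ ((q - 1) / q) * φ (S u)) * fun u => κ u ^ ((q - 1) / q) * ρ u ^ (1 / q)) u := by
    intro u
    have h1 : ρ u = ρ u ^ ((q - 1) / q) * ρ u ^ (1 / q) := by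
      rw [← ENNReal.rpow_add_of_nonneg _ _ hr (by positivity), hr1, ENNReal.rpow_one]
    have h2 : ρ u ^ ((q - 1) / q) ≤ κ u ^ ((q - 1) / q) * J u ^ ((q - 1) / q) := by
      rw [← ENNReal.mul_rpow_of_nonneg _ _ hr]
      exact ENNReal.rpow_le_rpow (hdom u) hr
    calc ρ u * φ (S u) = ρ u ^ ((q - 1) / q) * ρ u ^ (1 / q) * φ (S u) := by rw [← h1]
      _ ≤ κ u ^ ((q - 1) / q) * J u ^ ((q - 1) / q) * ρ u ^ (1 / q) * φ (S u) := by gcongr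
      _ = _ := by simp only [Pi.mul_apply]; ring
  rw [lintegral_stdGaussian (g := fun u => φ (S u)) (hφ.comp hScont.measurable)]
  refine (lintegral_mono hsplit).trans ?_
  have hFm : Measurable fun u => J u ^ ((q - 1) / q) * φ (S u) :=
    (hJm.pow_const _).mul (hφ.comp hScont.measurable)
  have hGm : Measurable fun u => κ u ^ ((q - 1) / q) * ρ u ^ (1 / q) :=
    (hκm.pow_const _).mul (hρ.pow_const _)
  refine (ENNReal.lintegral_mul_le_Lp_mul_Lq volume hconj hFm.aemeasurable
    hGm.aemeasurable).trans ?_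
  have hF : ∫⁻ u, (J u ^ ((q - 1) / q) * φ (S u)) ^ (q / (q - 1))
      ≤ ∫⁻ w, φ w ^ (q / (q - 1)) ∂(stdGaussian (EuclideanSpace ℝ (Fin d))) := by
    rw [lintegral_stdGaussian (hφ.pow_const _)]
    calc ∫⁻ u, (J u ^ ((q - 1) / q) * φ (S u)) ^ (q / (q - 1))
        = ∫⁻ u in univ, ENNReal.ofReal |(S' u).det| * (ρ (S u) * φ (S u) ^ (q / (q - 1))) := by
          rw [setLIntegral_univ]
          refine lintegral_congr fun u => ?_
          rw [ENNReal.mul_rpow_of_nonneg _ _ (by positivity), ← ENNReal.rpow_mul,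
            show (q - 1) / q * (q / (q - 1)) = 1 by field_simp, ENNReal.rpow_one, hJ, mul_assoc]
      _ = ∫⁻ w in S '' univ, ρ w * φ w ^ (q / (q - 1)) :=
          (lintegral_image_eq_lintegral_abs_det_fderiv_mul volume MeasurableSet.univ
            (fun u _ => (hS' u).hasFDerivWithinAt) hS.injOn
            (fun w => ρ w * φ w ^ (q / (q - 1)))).symm
      _ ≤ _ := setLIntegral_le_lintegral _ _
  have hG : ∫⁻ u, (κ u ^ ((q - 1) / q) * ρ u ^ (1 / q)) ^ q
      ≤ ENNReal.ofReal (Real.exp ((q - 1) * A + (q - 1) * e * √(d : ℝ)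
          + q * (q - 1) * e ^ 2 / 2)) := by
    have h1 : ∀ u, (κ u ^ ((q - 1) / q) * ρ u ^ (1 / q)) ^ q
        = ENNReal.ofReal (Real.exp ((q - 1) * (A + e ^ 2 / 2)))
          * (ρ u * ENNReal.ofReal (Real.exp ((q - 1) * e * ‖u‖))) := by
      intro u
      rw [ENNReal.mul_rpow_of_nonneg _ _ hq0.le, ← ENNReal.rpow_mul, ← ENNReal.rpow_mul,
        show (q - 1) / q * q = q - 1 by field_simp, show 1 / q * q = 1 by field_simp,
        ENNReal.rpow_one, hκ, ENNReal.ofReal_rpow_of_pos (Real.exp_pos _), ← Real.exp_mul,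
        show (A + e ^ 2 / 2 + e * ‖u‖) * (q - 1)
          = (q - 1) * (A + e ^ 2 / 2) + (q - 1) * e * ‖u‖ by ring, Real.exp_add,
        ENNReal.ofReal_mul (Real.exp_pos _).le]
      ring
    simp_rw [h1]
    rw [lintegral_const_mul _ (by fun_prop), ← lintegral_stdGaussian (by fun_prop)]
    refine (mul_le_mul_right (lintegral_exp_norm_stdGaussian_le hd
      (by positivity : 0 ≤ (q - 1) * e)) _).trans (le_of_eq ?_)
    rw [← ENNReal.ofReal_mul (Real.exp_pos _).le, ← Real.exp_add]
    congr 2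
    ring
  rw [mul_comm]
  refine mul_le_mul' (ENNReal.rpow_le_rpow hG (by positivity)) ?_
  rw [show 1 / (q / (q - 1)) = (q - 1) / q by field_simp]
  exact ENNReal.rpow_le_rpow hF hr

/-- A dimension-dependent Harnack inequality with power `q / (q - 1)` for the Verlet transition,
dual to a bound on the Rényi divergence between the transition laws from `x` and from `y`. -/
theorem lintegral_verlet_le (hf : PotentialAssumption f L M) (hd : 0 < d) (hh : 0 ≤ h)
    (hN : N * h = T) (hT : 0 < T) (hLT : L * T ^ 2 ≤ 1 / 12) (hq : 1 < q)
    (x y : EuclideanSpace ℝ (Fin d)) {ψ : EuclideanSpace ℝ (Fin d) → ℝ≥0∞} (hψ : Measurable ψ) :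
    ∫⁻ u, ψ ((verletStep f h)^[N] (x, u)).1 ∂(stdGaussian (EuclideanSpace ℝ (Fin d)))
      ≤ ENNReal.ofReal (Real.exp ((q - 1) * (8 * d * M * T ^ 2 + 3 * √(d : ℝ) / (2 * T)) * ‖x - y‖
          + 9 * q * (q - 1) / (8 * T ^ 2) * ‖x - y‖ ^ 2)) ^ (1 / q)
        * (∫⁻ w, ψ ((verletStep f h)^[N] (y, w)).1 ^ (q / (q - 1))
            ∂(stdGaussian (EuclideanSpace ℝ (Fin d)))) ^ ((q - 1) / q) := by
  obtain ⟨S, S', hinj, hder, heq, hclose, hdet⟩ :=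
    exists_velocity_change hf hd hh hN hT hLT x y
  have hcont : Continuous fun w => ((verletStep f h)^[N] (y, w)).1 :=
    continuous_fst.comp (((continuous_verletStep hf h).iterate N).comp (by fun_prop))
  have := lintegral_stdGaussian_comp_le hd hq (by positivity) hinj hder hclose hdet
    (φ := fun w => ψ ((verletStep f h)^[N] (y, w)).1) (hψ.comp hcont.measurable)
  simp only [heq] at this
  refine this.trans (le_of_eq ?_)
  congr 4
  field_simp
  ring

/-- The Harnack inequality for uHMC-v, with continuous test functions so that it passes to the
limit of vanishing step size. -/
theorem lintegral_uhmcPosition_le (hf : PotentialAssumption f L M) (hd : 0 < d) (hT : 0 < T)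
    (hh : 0 ≤ h) (hdvd : 0 < h → ∃ N : ℕ, T = N * h) (hLT : L * T ^ 2 ≤ 1 / 12) (hq : 1 < q)
    (x y : EuclideanSpace ℝ (Fin d)) {ψ : EuclideanSpace ℝ (Fin d) → ℝ≥0∞} (hψ : Continuous ψ)
    {B : ℝ≥0∞} (hB : B ≠ ∞) (hψB : ∀ z, ψ z ≤ B) :
    ∫⁻ u, ψ (uhmcPosition f T h (x, u)) ∂(stdGaussian (EuclideanSpace ℝ (Fin d)))
      ≤ ENNReal.ofReal (Real.exp ((q - 1) * (8 * d * M * T ^ 2 + 3 * √(d : ℝ) / (2 * T)) * ‖x - y‖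
          + 9 * q * (q - 1) / (8 * T ^ 2) * ‖x - y‖ ^ 2)) ^ (1 / q)
        * (∫⁻ w, ψ (uhmcPosition f T h (y, w)) ^ (q / (q - 1))
            ∂(stdGaussian (EuclideanSpace ℝ (Fin d)))) ^ ((q - 1) / q) := by
  have hq0 : 0 < q := by linarith
  have hq1 : 0 < q - 1 := by linarith
  obtain ⟨s, n, hs, hn, hlim⟩ := exists_tendsto_uhmcPosition hf hT hh hdvd hLT
  have hcont : ∀ i z, Continuous fun w => ((verletStep f (s i))^[n i] (z, w)).1 := fun i z =>
    continuous_fst.comp (((continuous_verletStep hf (s i)).iterate (n i)).comp (by fun_prop))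
  have hconv : ∀ {g : EuclideanSpace ℝ (Fin d) → ℝ≥0∞}, Continuous g → ∀ {C : ℝ≥0∞}, C ≠ ∞ →
      (∀ z, g z ≤ C) → ∀ z, Filter.Tendsto
        (fun i => ∫⁻ u, g ((verletStep f (s i))^[n i] (z, u)).1
          ∂(stdGaussian (EuclideanSpace ℝ (Fin d)))) Filter.atTop
        (nhds (∫⁻ u, g (uhmcPosition f T h (z, u))
          ∂(stdGaussian (EuclideanSpace ℝ (Fin d))))) := by
    intro g hg C hC hgC z
    refine tendsto_lintegral_of_dominated_convergence (fun _ => C)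
      (fun i => (hg.comp (hcont i z)).measurable) (fun i => Filter.Eventually.of_forall fun u => hgC _)
      (by simpa using hC) (Filter.Eventually.of_forall fun u => ?_)
    exact (hg.tendsto _).comp (hlim (z, u))
  have hψq : Continuous fun z => ψ z ^ (q / (q - 1)) := ENNReal.continuous_rpow_const.comp hψ
  have hψqB : ∀ z, ψ z ^ (q / (q - 1)) ≤ B ^ (q / (q - 1)) := fun z =>
    ENNReal.rpow_le_rpow (hψB z) (by positivity)
  refine le_of_tendsto_of_tendsto' (hconv hψ hB hψB x)
    (ENNReal.Tendsto.const_mul ((ENNReal.continuous_rpow_const.tendsto _).comp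
      (hconv hψq (ENNReal.rpow_ne_top_of_nonneg (by positivity) hB) hψqB y)) (Or.inr ?_))
    fun i => lintegral_verlet_le hf hd (hs i) (hn i) hT hLT hq x y hψ.measurable
  exact ENNReal.rpow_ne_top_of_nonneg (by positivity) ENNReal.ofReal_ne_top

end Harnack

/-! ### From Harnack inequalities to moments of the density -/

section Duality

variable {E : Type*} [NormedAddCommGroup E] [MeasurableSpace E] [BorelSpace E]

/-- A Hölder-type inequality between two measures extends from bounded continuous functions to
bounded measurable functions, by density in `L^p(μ + ν)`. -/
theorem lintegral_le_of_forall_continuous {μ ν : Measure E} [IsProbabilityMeasure μ]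
    [IsProbabilityMeasure ν] {p : ℝ} (hp : 1 ≤ p) {C : ℝ≥0∞} (hC : C ≠ ∞)
    (H : ∀ ψ : E → ℝ≥0∞, Continuous ψ → ∀ B : ℝ≥0∞, B ≠ ∞ → (∀ z, ψ z ≤ B) →
      ∫⁻ z, ψ z ∂μ ≤ C * (∫⁻ z, ψ z ^ p ∂ν) ^ (1 / p))
    {φ : E → ℝ≥0∞} (hφ : Measurable φ) {B : ℝ≥0∞} (hB : B ≠ ∞) (hφB : ∀ z, φ z ≤ B) :
    ∫⁻ z, φ z ∂μ ≤ C * (∫⁻ z, φ z ^ p ∂ν) ^ (1 / p) := by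
  have hp0 : 0 < p := by linarith
  have hpE : ENNReal.ofReal p ≠ 0 := by simpa using hp0
  have hnorm : ∀ (g : E → ℝ) (m : Measure E),
      eLpNorm g (ENNReal.ofReal p) m = (∫⁻ z, ‖g z‖ₑ ^ p ∂m) ^ (1 / p) := by
    intro g m
    rw [eLpNorm_eq_lintegral_rpow_enorm_toReal hpE ENNReal.ofReal_ne_top,
      ENNReal.toReal_ofReal hp0.le]
  have hφfin : ∀ z, φ z ≠ ∞ := fun z => ((hφB z).trans_lt hB.lt_top).ne
  set g₀ : E → ℝ := fun z => (φ z).toReal with hg₀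
  have hg₀φ : ∀ z, ‖g₀ z‖ₑ = φ z := fun z => by
    rw [hg₀, Real.enorm_eq_ofReal ENNReal.toReal_nonneg, ENNReal.ofReal_toReal (hφfin z)]
  have hg₀m : Measurable g₀ := hφ.ennreal_toReal
  have hmem : MemLp g₀ (ENNReal.ofReal p) (μ + ν) := by
    refine MemLp.of_bound hg₀m.aestronglyMeasurable B.toReal (Filter.Eventually.of_forall fun z => ?_)
    rw [hg₀, Real.norm_of_nonneg ENNReal.toReal_nonneg]
    exact ENNReal.toReal_mono hB (hφB z)
  have key : ∀ ε : ℝ≥0∞, ε ≠ 0 → eLpNorm g₀ 1 μ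
      ≤ ε + C * (eLpNorm g₀ (ENNReal.ofReal p) ν + ε) := by
    intro ε hε
    obtain ⟨g, hg, -⟩ := hmem.exists_boundedContinuous_eLpNorm_sub_le ENNReal.ofReal_ne_top hε
    have hgm : AEStronglyMeasurable g μ := g.continuous.aestronglyMeasurable
    have hgm' : AEStronglyMeasurable g ν := g.continuous.aestronglyMeasurable
    have h1 : eLpNorm (g₀ - (g : E → ℝ)) 1 μ ≤ ε := by
      refine (eLpNorm_le_eLpNorm_of_exponent_le (q := ENNReal.ofReal p) ?_
        (hg₀m.aestronglyMeasurable.sub hgm)).trans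
        ((eLpNorm_mono_measure _ (Measure.le_add_right le_rfl)).trans hg)
      simpa using hp
    have h2 : eLpNorm (g₀ - (g : E → ℝ)) (ENNReal.ofReal p) ν ≤ ε :=
      (eLpNorm_mono_measure _ (Measure.le_add_left le_rfl)).trans hg
    have h3 : eLpNorm g 1 μ ≤ C * eLpNorm g (ENNReal.ofReal p) ν := by
      rw [hnorm, eLpNorm_one_eq_lintegral_enorm]
      refine H (fun z => ‖g z‖ₑ) (continuous_enorm.comp g.continuous) ‖g‖ₑ enorm_ne_top fun z => ?_
      exact enorm_le_iff_norm_le.2 (g.norm_coe_le_norm z)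
    have h4 : eLpNorm g₀ 1 μ ≤ eLpNorm (g₀ - (g : E → ℝ)) 1 μ + eLpNorm g 1 μ := by
      have := eLpNorm_add_le (p := 1) (hg₀m.aestronglyMeasurable.sub hgm) hgm le_rfl
      rwa [sub_add_cancel] at this
    have h5 : eLpNorm g (ENNReal.ofReal p) ν ≤ eLpNorm g₀ (ENNReal.ofReal p) ν + ε := by
      have h6 := eLpNorm_sub_le (p := ENNReal.ofReal p) hg₀m.aestronglyMeasurable
        (hg₀m.aestronglyMeasurable.sub hgm') (by simpa using hp)
      rw [sub_sub_cancel] at h6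
      exact h6.trans (by gcongr)
    calc eLpNorm g₀ 1 μ ≤ ε + C * eLpNorm g (ENNReal.ofReal p) ν :=
          h4.trans (add_le_add h1 h3)
      _ ≤ _ := by gcongr
  have hlim : Filter.Tendsto (fun ε : ℝ≥0∞ => ε + C * (eLpNorm g₀ (ENNReal.ofReal p) ν + ε))
      (nhdsWithin 0 (Ioi 0)) (nhds (0 + C * (eLpNorm g₀ (ENNReal.ofReal p) ν + 0))) := by
    refine Filter.Tendsto.mono_left ?_ nhdsWithin_le_nhds
    exact Filter.tendsto_id.add (ENNReal.Tendsto.const_mul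
      (tendsto_const_nhds.add Filter.tendsto_id) (Or.inr hC))
  have hfinal := ge_of_tendsto hlim
    (Filter.eventually_of_mem self_mem_nhdsWithin fun ε hε => key ε (ne_of_gt hε))
  rw [zero_add, add_zero, hnorm, eLpNorm_one_eq_lintegral_enorm] at hfinal
  simpa only [hg₀φ] using hfinal

/-- The Hölder-type inequality with constant `C ^ (1 / q)` yields absolute continuity, and
`∫ (dμ/dν)^q dν ≤ C` upon testing it with truncations of `(dμ/dν) ^ (q - 1)`. -/
theorem lintegral_rnDeriv_rpow_le {μ ν : Measure E} [IsProbabilityMeasure μ]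
    [IsProbabilityMeasure ν] {q : ℝ} (hq : 1 < q) {C : ℝ≥0∞} (hC : C ≠ ∞)
    (H : ∀ ψ : E → ℝ≥0∞, Continuous ψ → ∀ B : ℝ≥0∞, B ≠ ∞ → (∀ z, ψ z ≤ B) →
      ∫⁻ z, ψ z ∂μ ≤ C ^ (1 / q) * (∫⁻ z, ψ z ^ (q / (q - 1)) ∂ν) ^ ((q - 1) / q)) :
    μ ≪ ν ∧ ∫⁻ z, μ.rnDeriv ν z ^ q ∂ν ≤ C := by
  have hq0 : 0 < q := by linarith
  have hq1 : 0 < q - 1 := by linarith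
  have hexp : 1 / (q / (q - 1)) = (q - 1) / q := by field_simp
  have H' : ∀ φ : E → ℝ≥0∞, Measurable φ → ∀ B : ℝ≥0∞, B ≠ ∞ → (∀ z, φ z ≤ B) →
      ∫⁻ z, φ z ∂μ ≤ C ^ (1 / q) * (∫⁻ z, φ z ^ (q / (q - 1)) ∂ν) ^ ((q - 1) / q) := by
    intro φ hφ B hB hφB
    rw [← hexp]
    refine lintegral_le_of_forall_continuous ((one_le_div hq1).2 (by linarith))
      (ENNReal.rpow_ne_top_of_nonneg (by positivity) hC) (fun ψ hψ B' hB' hψB' => ?_) hφ hB hφB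
    rw [hexp]
    exact H ψ hψ B' hB' hψB'
  have hac : μ ≪ ν := by
    refine Measure.AbsolutelyContinuous.mk fun s hs hνs => ?_
    have h1 := H' (s.indicator 1) (measurable_one.indicator hs) 1 ENNReal.one_ne_top
      (fun z => indicator_le_self' (fun _ _ => zero_le_one) z)
    have h2 : ∫⁻ z, (s.indicator (1 : E → ℝ≥0∞) z) ^ (q / (q - 1)) ∂ν = 0 := by
      have h3 : ∀ z, (s.indicator (1 : E → ℝ≥0∞) z) ^ (q / (q - 1)) = s.indicator 1 z := by
        intro z
        by_cases hz : z ∈ s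
        · simp [hz]
        · simp only [hz, not_false_eq_true, indicator_of_notMem]
          exact ENNReal.zero_rpow_of_pos (by positivity)
      simp_rw [h3]
      rw [lintegral_indicator_one hs, hνs]
    rw [h2, ENNReal.zero_rpow_of_pos (by positivity), mul_zero, lintegral_indicator_one hs] at h1
    exact le_antisymm h1 zero_le
  refine ⟨hac, ?_⟩
  set r := μ.rnDeriv ν with hr
  have hrm : Measurable r := Measure.measurable_rnDeriv μ ν
  have htrunc : ∀ n : ℕ, ∫⁻ z, (min (r z) n) ^ q ∂ν ≤ C := by
    intro n
    set a := ∫⁻ z, (min (r z) n) ^ q ∂ν with ha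
    have hafin : a ≠ ∞ := by
      refine (lt_of_le_of_lt (lintegral_mono (g := fun _ => (n : ℝ≥0∞) ^ q) fun z =>
        ENNReal.rpow_le_rpow (min_le_right _ _) hq0.le) ?_).ne
      rw [lintegral_const, measure_univ, mul_one]
      exact ENNReal.rpow_lt_top_of_nonneg hq0.le (ENNReal.natCast_ne_top n)
    have hmm : Measurable fun z => min (r z) (n : ℝ≥0∞) := hrm.min measurable_const
    have h1 : a ≤ ∫⁻ z, (min (r z) n) ^ (q - 1) ∂μ := by
      rw [← lintegral_rnDeriv_mul hac (hmm.pow_const _).aemeasurable]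
      refine lintegral_mono fun z => ?_
      have e : (min (r z) (n : ℝ≥0∞)) ^ q
          = min (r z) n * (min (r z) (n : ℝ≥0∞)) ^ (q - 1) := by
        conv_rhs => rw [← ENNReal.rpow_one (min (r z) (n : ℝ≥0∞)), ← ENNReal.rpow_mul, one_mul,
          ← ENNReal.rpow_add_of_nonneg _ _ zero_le_one hq1.le]
        congr 1
        ring
      rw [e]
      gcongr
      exact min_le_left _ _
    have h2 := H' _ (hmm.pow_const (q - 1)) ((n : ℝ≥0∞) ^ (q - 1))
      (ENNReal.rpow_ne_top_of_nonneg hq1.le (ENNReal.natCast_ne_top n))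
      (fun z => ENNReal.rpow_le_rpow (min_le_right _ _) hq1.le)
    simp_rw [← ENNReal.rpow_mul, show (q - 1) * (q / (q - 1)) = q by field_simp] at h2
    -- a finite `a` may be cancelled, leaving `a ^ (1 / q) ≤ C ^ (1 / q)`
    have h3 : a ≤ C ^ (1 / q) * a ^ ((q - 1) / q) := h1.trans h2
    rcases eq_or_ne a 0 with h0 | h0
    · rw [h0]; exact zero_le
    · have h4 : a = a ^ (1 / q) * a ^ ((q - 1) / q) := by
        rw [← ENNReal.rpow_add_of_nonneg _ _ (by positivity) (by positivity)]
        rw [show 1 / q + (q - 1) / q = 1 by field_simp; ring, ENNReal.rpow_one]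
      have hb0 : a ^ ((q - 1) / q) ≠ 0 := (ENNReal.rpow_pos (pos_iff_ne_zero.2 h0) hafin).ne'
      have hbt : a ^ ((q - 1) / q) ≠ ∞ := ENNReal.rpow_ne_top_of_nonneg (by positivity) hafin
      have h5 : a ^ (1 / q) * a ^ ((q - 1) / q) ≤ C ^ (1 / q) * a ^ ((q - 1) / q) :=
        h4 ▸ h3
      have h6 := (ENNReal.mul_le_mul_iff_left hb0 hbt).1 h5
      exact (ENNReal.rpow_le_rpow_iff (by positivity)).1 h6
  have hlim : Filter.Tendsto (fun n : ℕ => ∫⁻ z, (min (r z) n) ^ q ∂ν) Filter.atTop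
      (nhds (∫⁻ z, r z ^ q ∂ν)) := by
    refine lintegral_tendsto_of_tendsto_of_monotone
      (fun n => ((hrm.min measurable_const).pow_const _).aemeasurable)
      (Filter.Eventually.of_forall fun z n m hnm => ?_) (Filter.Eventually.of_forall fun z => ?_)
    · exact ENNReal.rpow_le_rpow (min_le_min_left _ (by exact_mod_cast hnm)) hq0.le
    · refine (ENNReal.continuous_rpow_const.tendsto _).comp ?_
      have := (tendsto_const_nhds (x := r z)).min ENNReal.tendsto_nat_nhds_top
      simpa using this
  exact le_of_tendsto' hlim htrunc

end Duality

/-- Integrating pointwise Harnack inequalities over a coupling. -/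
theorem lintegral_map_le_of_coupling {E Ω : Type*} [MeasurableSpace E] [MeasurableSpace Ω] {μ ν : Measure E}
    [IsProbabilityMeasure μ] [IsProbabilityMeasure ν] {P : Measure Ω} [IsProbabilityMeasure P]
    {Φ : E × Ω → E} (hΦ : Measurable Φ) {γ : Measure (E × E)} (hγ : IsCouplingOf γ μ ν)
    {q : ℝ} (hq : 1 < q) {c : E × E → ℝ≥0∞} (hc : Measurable c) {ψ : E → ℝ≥0∞} (hψ : Measurable ψ)
    (H : ∀ x y, ∫⁻ u, ψ (Φ (x, u)) ∂P
      ≤ c (x, y) ^ (1 / q) * (∫⁻ w, ψ (Φ (y, w)) ^ (q / (q - 1)) ∂P) ^ ((q - 1) / q)) :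
    ∫⁻ z, ψ z ∂((μ.prod P).map Φ)
      ≤ (∫⁻ p, c p ∂γ) ^ (1 / q)
        * (∫⁻ z, ψ z ^ (q / (q - 1)) ∂((ν.prod P).map Φ)) ^ ((q - 1) / q) := by
  have hq0 : 0 < q := by linarith
  have hq1 : 0 < q - 1 := by linarith
  have hconj : q.HolderConjugate (q / (q - 1)) := by
    rw [Real.holderConjugate_iff]
    refine ⟨hq, ?_⟩
    field_simp
    ring
  have hswap : ∀ {g : E → ℝ≥0∞}, Measurable g → ∀ (m : Measure E) [IsProbabilityMeasure m],
      ∫⁻ z, g z ∂((m.prod P).map Φ) = ∫⁻ x, ∫⁻ u, g (Φ (x, u)) ∂P ∂m := by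
    intro g hg m _
    rw [lintegral_map hg hΦ, lintegral_prod (fun a => g (Φ a)) (hg.comp hΦ).aemeasurable]
  have hin : ∀ {g : E → ℝ≥0∞}, Measurable g → Measurable fun x => ∫⁻ u, g (Φ (x, u)) ∂P :=
    fun hg => (hg.comp hΦ).lintegral_prod_right'
  have hψq : Measurable fun z => ψ z ^ (q / (q - 1)) := hψ.pow_const _
  rw [hswap hψ, hswap hψq]
  conv_lhs => rw [← hγ.1]
  conv_rhs => rw [← hγ.2]
  rw [lintegral_map (hin hψ) measurable_fst, lintegral_map (hin hψq) measurable_snd]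
  have hcm : Measurable fun p => c p ^ (1 / q) := hc.pow_const _
  have hGm : Measurable fun p : E × E =>
      (∫⁻ w, ψ (Φ (p.2, w)) ^ (q / (q - 1)) ∂P) ^ ((q - 1) / q) :=
    ((hin hψq).comp measurable_snd).pow_const _
  refine (lintegral_mono fun p : E × E => H p.1 p.2).trans ?_
  refine (ENNReal.lintegral_mul_le_Lp_mul_Lq γ hconj hcm.aemeasurable hGm.aemeasurable).trans
    (le_of_eq ?_)
  simp_rw [← ENNReal.rpow_mul]
  rw [show 1 / q * q = 1 by field_simp, show (q - 1) / q * (q / (q - 1)) = 1 by field_simp,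
    show 1 / (q / (q - 1)) = (q - 1) / q by field_simp]
  simp_rw [ENNReal.rpow_one]

/-! ### Exponential moments under a nearly optimal coupling -/

section Moments

variable {E : Type*} [NormedAddCommGroup E] [MeasurableSpace E]

/-- If `W_ψ(μ, ν) < w`, some coupling satisfies `E exp(‖X - Y‖² / w²) ≤ 2`. -/
theorem exists_coupling_of_orliczWasserstein_lt [BorelSpace E] [SecondCountableTopology E]
    {μ ν : Measure E} [IsProbabilityMeasure μ] {w : ℝ}
    (hw : orliczWasserstein expSqOrlicz μ ν < ENNReal.ofReal w) :
    ∃ γ : Measure (E × E), IsCouplingOf γ μ ν ∧ IsProbabilityMeasure γ ∧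
      ∫⁻ p, ENNReal.ofReal (Real.exp ((‖p.1 - p.2‖ / w) ^ 2)) ∂γ ≤ 2 := by
  have hw0 : 0 < w := by
    by_contra hneg
    rw [ENNReal.ofReal_of_nonpos (not_lt.1 hneg)] at hw
    exact not_lt_zero hw
  simp only [orliczWasserstein, orliczNorm, iInf_lt_iff] at hw
  obtain ⟨γ, hγ, l, ⟨hl, hint⟩, hlw⟩ := hw
  have hlw' : l < w := (ENNReal.ofReal_lt_ofReal_iff hw0).1 hlw
  have hprob : IsProbabilityMeasure γ := by
    have : IsProbabilityMeasure (γ.map Prod.fst) := by rw [hγ.1]; infer_instance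
    exact Measure.isProbabilityMeasure_of_map (f := Prod.fst)
  refine ⟨γ, hγ, hprob, ?_⟩
  have hpt : ∀ p : E × E, ENNReal.ofReal (Real.exp ((‖p.1 - p.2‖ / w) ^ 2))
      ≤ ENNReal.ofReal (expSqOrlicz (‖p.1 - p.2‖ / l)) + 1 := by
    intro p
    rw [← ENNReal.ofReal_one, ← ENNReal.ofReal_add _ zero_le_one]
    · refine ENNReal.ofReal_le_ofReal ?_
      rw [expSqOrlicz, sub_add_cancel]
      gcongr
    · rw [expSqOrlicz, sub_nonneg]
      exact Real.one_le_exp (sq_nonneg _)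
  calc _ ≤ ∫⁻ p, (ENNReal.ofReal (expSqOrlicz (‖p.1 - p.2‖ / l)) + 1) ∂γ := lintegral_mono hpt
    _ = ∫⁻ p, ENNReal.ofReal (expSqOrlicz (‖p.1 - p.2‖ / l)) ∂γ + 1 := by
        rw [lintegral_add_right _ measurable_const, lintegral_one, measure_univ]
    _ ≤ 1 + 1 := by gcongr
    _ = 2 := one_add_one_eq_two

/-- Exponential moments of `δ₁ Z + δ₂ Z²` from a `ψ`-norm bound on `Z`: linearise
`δ₁ Z ≤ δ₁ (t w + Z² / (t w)) / 2`, then use Jensen's inequality for the power `θ ≤ 1`. -/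
theorem lintegral_exp_linear_add_sq_le {Ω : Type*} [MeasurableSpace Ω] {γ : Measure Ω}
    [IsProbabilityMeasure γ] {Z : Ω → ℝ} {w t δ₁ δ₂ : ℝ} (hw : 0 < w)
    (ht : 0 < t) (hδ₁ : 0 ≤ δ₁) (hδ₂ : 0 ≤ δ₂)
    (hZ : ∫⁻ p, ENNReal.ofReal (Real.exp ((Z p / w) ^ 2)) ∂γ ≤ 2)
    (hθ : δ₁ * w / (2 * t) + δ₂ * w ^ 2 ≤ 1) :
    ∫⁻ p, ENNReal.ofReal (Real.exp (δ₁ * Z p + δ₂ * Z p ^ 2)) ∂γ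
      ≤ ENNReal.ofReal (Real.exp (δ₁ * t * w / 2
          + (δ₁ * w / (2 * t) + δ₂ * w ^ 2) * Real.log 2)) := by
  set θ := δ₁ * w / (2 * t) + δ₂ * w ^ 2 with hθdef
  have hθ0 : 0 ≤ θ := by positivity
  have hpt : ∀ p, ENNReal.ofReal (Real.exp (δ₁ * Z p + δ₂ * Z p ^ 2))
      ≤ ENNReal.ofReal (Real.exp (δ₁ * t * w / 2 + θ * Real.log 2))
        * (ENNReal.ofReal (1 - θ)
          + ENNReal.ofReal (θ / 2) * ENNReal.ofReal (Real.exp ((Z p / w) ^ 2))) := by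
    intro p
    rw [← ENNReal.ofReal_mul (by positivity), ← ENNReal.ofReal_add (by linarith) (by positivity),
      ← ENNReal.ofReal_mul (Real.exp_pos _).le]
    refine ENNReal.ofReal_le_ofReal ?_
    have h1 : δ₁ * Z p + δ₂ * Z p ^ 2 ≤ δ₁ * t * w / 2 + θ * (Z p / w) ^ 2 := by
      have e : δ₁ * t * w / 2 + θ * (Z p / w) ^ 2 - (δ₁ * Z p + δ₂ * Z p ^ 2)
          = δ₁ * (t * w - Z p) ^ 2 / (2 * t * w) := by
        rw [hθdef]; field_simp; ring
      have : 0 ≤ δ₁ * (t * w - Z p) ^ 2 / (2 * t * w) := by positivity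
      linarith
    have h2 : Real.exp (θ * ((Z p / w) ^ 2 - Real.log 2))
        ≤ 1 - θ + θ / 2 * Real.exp ((Z p / w) ^ 2) := by
      have := convexOn_exp.2 (mem_univ 0) (mem_univ ((Z p / w) ^ 2 - Real.log 2))
        (sub_nonneg.2 hθ) hθ0 (by ring)
      simp only [smul_eq_mul, mul_zero, zero_add, Real.exp_zero, mul_one] at this
      rw [Real.exp_sub, Real.exp_log two_pos] at this
      linarith
    calc Real.exp (δ₁ * Z p + δ₂ * Z p ^ 2)
        ≤ Real.exp (δ₁ * t * w / 2 + θ * (Z p / w) ^ 2) := Real.exp_le_exp.2 h1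
      _ = Real.exp (δ₁ * t * w / 2 + θ * Real.log 2)
          * Real.exp (θ * ((Z p / w) ^ 2 - Real.log 2)) := by rw [← Real.exp_add]; ring_nf
      _ ≤ _ := by gcongr
  refine (lintegral_mono hpt).trans ?_
  rw [lintegral_const_mul' _ _ ENNReal.ofReal_ne_top, lintegral_add_left measurable_const,
    lintegral_const_mul' _ _ ENNReal.ofReal_ne_top, lintegral_const, measure_univ, mul_one]
  refine mul_le_of_le_one_right zero_le ?_
  calc _ ≤ ENNReal.ofReal (1 - θ) + ENNReal.ofReal (θ / 2) * 2 := by gcongr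
    _ = 1 := by
      rw [← ENNReal.ofReal_ofNat 2, ← ENNReal.ofReal_mul (by positivity),
        ← ENNReal.ofReal_add (by linarith) (by positivity)]
      rw [show 1 - θ + θ / 2 * 2 = 1 by ring, ENNReal.ofReal_one]

end Moments

/-! ### Iterating the transition operator -/

section Final

variable {d : ℕ} {f : EuclideanSpace ℝ (Fin d) → ℝ} {L M h T q : ℝ}

theorem isProbabilityMeasure_uhmcKernel_iterate (hf : PotentialAssumption f L M) (hT : 0 < T)
    (hh : 0 ≤ h) (hdvd : 0 < h → ∃ N : ℕ, T = N * h) (hLT : L * T ^ 2 ≤ 1 / 12)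
    (μ : Measure (EuclideanSpace ℝ (Fin d))) [IsProbabilityMeasure μ] (k : ℕ) :
    IsProbabilityMeasure ((uhmcKernel f T h)^[k] μ) := by
  induction k with
  | zero => assumption
  | succ k ih =>
    rw [Function.iterate_succ_apply']
    exact Measure.isProbabilityMeasure_map
      (measurable_uhmcPosition hf hT hh hdvd hLT).aemeasurable

/-- One further transition turns an Orlicz–Wasserstein bound on `μ` into a bound on the moment of
order `q` of the density of `μ P` with respect to the stationary distribution. -/
theorem lintegral_rnDeriv_uhmcKernel_le (hf : PotentialAssumption f L M) (hd : 0 < d) (hT : 0 < T)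
    (hh : 0 ≤ h) (hdvd : 0 < h → ∃ N : ℕ, T = N * h) (hLT : L * T ^ 2 ≤ 1 / 12) (hq : 1 < q)
    {μ ν : Measure (EuclideanSpace ℝ (Fin d))} [IsProbabilityMeasure μ] [IsProbabilityMeasure ν]
    (hν : uhmcKernel f T h ν = ν) {δ₁ δ₂ : ℝ}
    (hδ₁ : δ₁ = (q - 1) * (8 * d * M * T ^ 2 + 3 * √(d : ℝ) / (2 * T)))
    (hδ₂ : δ₂ = 9 * q * (q - 1) / (8 * T ^ 2)) {w t : ℝ} (ht : 0 < t)
    (hw : orliczWasserstein expSqOrlicz μ ν < ENNReal.ofReal w)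
    (hθ : δ₁ * w / (2 * t) + δ₂ * w ^ 2 ≤ 1) :
    uhmcKernel f T h μ ≪ ν ∧ ∫⁻ z, (uhmcKernel f T h μ).rnDeriv ν z ^ q ∂ν
      ≤ ENNReal.ofReal (Real.exp (δ₁ * t * w / 2
          + (δ₁ * w / (2 * t) + δ₂ * w ^ 2) * Real.log 2)) := by
  have hM := hf.nonneg_third
  have hq1 : 0 < q - 1 := by linarith
  have hw0 : 0 < w := by
    by_contra hneg
    rw [ENNReal.ofReal_of_nonpos (not_lt.1 hneg)] at hw
    exact not_lt_zero hw
  have hδ₁0 : 0 ≤ δ₁ := by rw [hδ₁]; positivity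
  have hδ₂0 : 0 ≤ δ₂ := by rw [hδ₂]; positivity
  have hΦ := measurable_uhmcPosition hf hT hh hdvd hLT
  have : IsProbabilityMeasure (uhmcKernel f T h μ) :=
    isProbabilityMeasure_uhmcKernel_iterate hf hT hh hdvd hLT μ 1
  obtain ⟨γ, hγ, hγp, hmom⟩ := exists_coupling_of_orliczWasserstein_lt hw
  have hmoment := lintegral_exp_linear_add_sq_le hw0 ht hδ₁0 hδ₂0 hmom hθ
  refine lintegral_rnDeriv_rpow_le hq ENNReal.ofReal_ne_top fun ψ hψ B hB hψB => ?_
  have hH := lintegral_map_le_of_coupling hΦ hγ hq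
    (c := fun p => ENNReal.ofReal (Real.exp (δ₁ * ‖p.1 - p.2‖ + δ₂ * ‖p.1 - p.2‖ ^ 2)))
    (by fun_prop) hψ.measurable (fun x y => by
      rw [hδ₁, hδ₂]
      exact lintegral_uhmcPosition_le hf hd hT hh hdvd hLT hq x y hψ hB hψB)
  change ∫⁻ z, ψ z ∂(uhmcKernel f T h μ) ≤ _ * (∫⁻ z, _ ∂(uhmcKernel f T h ν)) ^ _ at hH
  rw [hν] at hH
  refine hH.trans ?_
  gcongr

/-- The threshold on the number of steps, in real terms. -/
theorem mul_exp_le_of_log_le {c₁ c₂ B D w : ℝ} (hc₁ : 0 < c₁) (hc₂ : 0 < c₂) (hB : 0 < B)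
    (hD : 0 < D) (hw : 0 ≤ w) {k : ℕ}
    (hk : ((1 / c₂ : ℝ) : EReal) * ENNReal.log (ENNReal.ofReal c₁ * ENNReal.ofReal w
      / ENNReal.ofReal B * ENNReal.ofReal D) ≤ ((k : ℝ) : EReal)) :
    c₁ * Real.exp (-c₂ * k) * w * D ≤ B := by
  rcases hw.eq_or_lt with rfl | hw
  · simp [hB.le]
  rw [← ENNReal.ofReal_mul hc₁.le, ← ENNReal.ofReal_div_of_pos hB,
    ← ENNReal.ofReal_mul (by positivity), ENNReal.log_ofReal_of_pos (by positivity),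
    ← EReal.coe_mul, EReal.coe_le_coe_iff] at hk
  have h1 : Real.log (c₁ * w / B * D) ≤ c₂ * k := by
    rw [one_div, inv_mul_le_iff₀ hc₂] at hk
    exact hk
  rw [Real.log_le_iff_le_exp (by positivity)] at h1
  have h2 : c₁ * w * D ≤ B * Real.exp (c₂ * k) := by
    calc c₁ * w * D = c₁ * w / B * D * B := by field_simp
      _ ≤ Real.exp (c₂ * k) * B := by gcongr
      _ = _ := mul_comm _ _
  calc c₁ * Real.exp (-c₂ * k) * w * D = Real.exp (-c₂ * k) * (c₁ * w * D) := by ring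
    _ ≤ Real.exp (-c₂ * k) * (B * Real.exp (c₂ * k)) := by gcongr
    _ = B * (Real.exp (-c₂ * k) * Real.exp (c₂ * k)) := by ring
    _ = B := by rw [← Real.exp_add, show -c₂ * (k : ℝ) + c₂ * k = 0 by ring, Real.exp_zero, mul_one]

/-- The number `4 s / (δ₁ + √(δ₁² + 16 s² δ₂))` is the positive root of
`δ₁ w / (2 s) + δ₂ w² = 1`. -/
theorem quadratic_le_one_of_mul_le {s δ₁ δ₂ w : ℝ} (hs : 0 < s) (hδ₁ : 0 < δ₁) (hδ₂ : 0 < δ₂)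
    (hw : 0 ≤ w) (h : w * (δ₁ + √(δ₁ ^ 2 + 16 * s ^ 2 * δ₂)) ≤ 4 * s) :
    δ₁ * w / (2 * s) + δ₂ * w ^ 2 ≤ 1 := by
  set R := √(δ₁ ^ 2 + 16 * s ^ 2 * δ₂) with hR
  have hR2 : R ^ 2 = δ₁ ^ 2 + 16 * s ^ 2 * δ₂ := Real.sq_sqrt (by positivity)
  have hR0 : 0 ≤ R := Real.sqrt_nonneg _
  have h1 : w * R ≤ 4 * s - δ₁ * w := by linarith
  have h2 : (w * R) ^ 2 ≤ (4 * s - δ₁ * w) ^ 2 := by gcongr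
  have h3 : s * (2 * s * δ₂ * w ^ 2 + δ₁ * w) ≤ s * (2 * s) := by
    have : (w * R) ^ 2 = w ^ 2 * (δ₁ ^ 2 + 16 * s ^ 2 * δ₂) := by rw [mul_pow, hR2]
    nlinarith
  have h4 := le_of_mul_le_mul_left h3 hs
  have e : δ₁ * w / (2 * s) + δ₂ * w ^ 2 = (2 * s * δ₂ * w ^ 2 + δ₁ * w) / (2 * s) := by
    field_simp
    ring
  rw [e, div_le_one (by positivity)]
  exact h4

/-- The moment bound at the critical distance `w`, reached in the limit of nearly optimal couplings:
for `t > √log 2` the constraint on the exponent is strict, so that it survives a small increase of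
`w`. -/
theorem lintegral_rnDeriv_uhmcKernel_le_of_quadratic_le (hf : PotentialAssumption f L M)
    (hd : 0 < d) (hT : 0 < T) (hh : 0 ≤ h) (hdvd : 0 < h → ∃ N : ℕ, T = N * h)
    (hLT : L * T ^ 2 ≤ 1 / 12) (hq : 1 < q)
    {μ ν : Measure (EuclideanSpace ℝ (Fin d))} [IsProbabilityMeasure μ] [IsProbabilityMeasure ν]
    (hν : uhmcKernel f T h ν = ν) {δ₁ δ₂ : ℝ} (hδ₁0 : 0 < δ₁)
    (hδ₁ : δ₁ = (q - 1) * (8 * d * M * T ^ 2 + 3 * √(d : ℝ) / (2 * T)))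
    (hδ₂ : δ₂ = 9 * q * (q - 1) / (8 * T ^ 2)) {w : ℝ} (hw0 : 0 ≤ w)
    (hw : orliczWasserstein expSqOrlicz μ ν ≤ ENNReal.ofReal w)
    (hθ : δ₁ * w / (2 * √(Real.log 2)) + δ₂ * w ^ 2 ≤ 1) :
    uhmcKernel f T h μ ≪ ν ∧ ∫⁻ z, (uhmcKernel f T h μ).rnDeriv ν z ^ q ∂ν
      ≤ ENNReal.ofReal (Real.exp (√(Real.log 2) * δ₁ * w + Real.log 2 * δ₂ * w ^ 2)) := by
  have hlog2 : 0 < Real.log 2 := Real.log_pos one_lt_two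
  set s := √(Real.log 2) with hs
  have hs0 : 0 < s := Real.sqrt_pos.2 hlog2
  have hs2 : s ^ 2 = Real.log 2 := Real.sq_sqrt hlog2.le
  have hev : ∀ t, s < t → ∀ᶠ w' in nhdsWithin w (Ioi w),
      uhmcKernel f T h μ ≪ ν ∧ ∫⁻ z, (uhmcKernel f T h μ).rnDeriv ν z ^ q ∂ν
        ≤ ENNReal.ofReal (Real.exp (δ₁ * t * w' / 2
          + (δ₁ * w' / (2 * t) + δ₂ * w' ^ 2) * Real.log 2)) := by
    intro t hst
    have ht0 : 0 < t := hs0.trans hst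
    have hlt : δ₁ * w / (2 * t) + δ₂ * w ^ 2 < 1 := by
      rcases hw0.eq_or_lt with rfl | hw0
      · simp
      · refine lt_of_lt_of_le ?_ hθ
        gcongr
    have hc : ContinuousAt (fun w' => δ₁ * w' / (2 * t) + δ₂ * w' ^ 2) w := by fun_prop
    filter_upwards [self_mem_nhdsWithin,
      (hc.eventually (gt_mem_nhds hlt)).filter_mono nhdsWithin_le_nhds] with w' hw' hθ'
    have hw'' : w < w' := hw'
    exact lintegral_rnDeriv_uhmcKernel_le hf hd hT hh hdvd hLT hq hν hδ₁ hδ₂ ht0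
      (hw.trans_lt ((ENNReal.ofReal_lt_ofReal_iff (hw0.trans_lt hw'')).2 hw'')) hθ'.le
  refine ⟨((hev (s + 1) (by linarith)).exists.choose_spec).1, ?_⟩
  have hbound : ∀ t, s < t → ∫⁻ z, (uhmcKernel f T h μ).rnDeriv ν z ^ q ∂ν
      ≤ ENNReal.ofReal (Real.exp (δ₁ * t * w / 2
          + (δ₁ * w / (2 * t) + δ₂ * w ^ 2) * Real.log 2)) := by
    intro t hst
    have hc : Continuous fun w' => ENNReal.ofReal (Real.exp (δ₁ * t * w' / 2
        + (δ₁ * w' / (2 * t) + δ₂ * w' ^ 2) * Real.log 2)) :=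
      ENNReal.continuous_ofReal.comp (by fun_prop)
    exact ge_of_tendsto ((hc.tendsto w).mono_left nhdsWithin_le_nhds)
      ((hev t hst).mono fun _ hx => hx.2)
  have hc : ContinuousAt (fun t => ENNReal.ofReal (Real.exp (δ₁ * t * w / 2
      + (δ₁ * w / (2 * t) + δ₂ * w ^ 2) * Real.log 2))) s := by
    refine ENNReal.continuous_ofReal.continuousAt.comp ?_
    have h2s : 2 * s ≠ 0 := by positivity
    fun_prop (disch := assumption)
  have hfin := ge_of_tendsto (hc.tendsto.mono_left nhdsWithin_le_nhds)
    (Filter.eventually_of_mem (self_mem_nhdsWithin (s := Ioi s)) hbound)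
  refine hfin.trans (le_of_eq ?_)
  congr 2
  rw [← hs2]
  field_simp
  ring

theorem renyiDiv_le_of_lintegral_le {E : Type*} [MeasurableSpace E] {μ ν : Measure E}
    (hq : 1 < q) {b R : ℝ} (hac : μ ≪ ν)
    (hint : ∫⁻ z, μ.rnDeriv ν z ^ q ∂ν ≤ ENNReal.ofReal (Real.exp b)) (hR : (q - 1)⁻¹ * b ≤ R) :
    renyiDiv q μ ν ≤ (R : EReal) := by
  have hq1 : 0 < q - 1 := by linarith
  rw [renyiDiv, if_pos hac]
  have h1 : ENNReal.log (∫⁻ z, μ.rnDeriv ν z ^ q ∂ν) ≤ (b : EReal) := by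
    refine (ENNReal.log_monotone hint).trans (le_of_eq ?_)
    rw [ENNReal.log_ofReal_of_pos (Real.exp_pos b), Real.log_exp]
  calc _ ≤ (((q - 1)⁻¹ : ℝ) : EReal) * (b : EReal) :=
        mul_le_mul_of_nonneg_left h1 (by exact_mod_cast (inv_pos.2 hq1).le)
    _ = (((q - 1)⁻¹ * b : ℝ) : EReal) := (EReal.coe_mul _ _).symm
    _ ≤ _ := by exact_mod_cast hR

theorem renyiDiv_self {E : Type*} [MeasurableSpace E] (q : ℝ) (ν : Measure E)
    [IsProbabilityMeasure ν] : renyiDiv q ν ν = 0 := by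
  rw [renyiDiv, if_pos Measure.AbsolutelyContinuous.rfl]
  have : ∫⁻ z, ν.rnDeriv ν z ^ q ∂ν = 1 := by
    rw [lintegral_congr_ae (g := fun _ => 1), lintegral_one, measure_univ]
    filter_upwards [Measure.rnDeriv_self ν] with z hz
    rw [hz, ENNReal.one_rpow]
  rw [this, ENNReal.log_one, mul_zero]

end Final

end

theorem mainTheorem3 (d : ℕ) (f : EuclideanSpace ℝ (Fin d) → ℝ) (L M T h : ℝ)
    (hf : PotentialAssumption f L M)
    (hT : 0 < T) (hh : 0 ≤ h) (hdvd : 0 < h → ∃ N : ℕ, T = N * h)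
    (hLT : L * (T ^ 2 + T * h) ≤ 1 / 12)
    (ν : Measure (EuclideanSpace ℝ (Fin d))) (c₁ c₂ : ℝ)
    (hmix : OrliczMixing (uhmcKernel f T h) ν c₁ c₂)
    (μ : Measure (EuclideanSpace ℝ (Fin d))) [IsProbabilityMeasure μ]
    (q : ℝ) (hq : 1 < q) (δ₁ δ₂ : ℝ)
    (hδ₁ : δ₁ = (q - 1) * (8 * d * M * T ^ 2 + 3 * √(d : ℝ) / (2 * T)))
    (hδ₂ : δ₂ = 9 * q * (q - 1) / (8 * T ^ 2))
    (k : ℕ)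
    (hk : ((1 / c₂ : ℝ) : EReal) *
        ENNReal.log (ENNReal.ofReal c₁ * orliczWasserstein expSqOrlicz μ ν
          / ENNReal.ofReal (4 * √(Real.log 2))
          * ENNReal.ofReal (δ₁ + √(δ₁ ^ 2 + 16 * Real.log 2 * δ₂))) ≤ ((k : ℝ) : EReal)) :
    renyiDiv q ((uhmcKernel f T h)^[k + 1] μ) ν
      ≤ ((ENNReal.ofReal ((δ₁ + δ₂) / (q - 1) * √(Real.log 2) * c₁ ^ 2 * Real.exp (-c₂ * k))
          * max 1 (orliczWasserstein expSqOrlicz μ ν ^ 2) : ℝ≥0∞) : EReal) := by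
  have hLT' : L * T ^ 2 ≤ 1 / 12 := by
    have : 0 ≤ L * (T * h) := mul_nonneg hf.nonneg_hess (by positivity)
    linarith
  have := hmix.isProbabilityMeasure
  have hprob := isProbabilityMeasure_uhmcKernel_iterate hf hT hh hdvd hLT' μ
  rcases Nat.eq_zero_or_pos d with hd0 | hd
  · -- a point carries a single probability measure
    have : Subsingleton (EuclideanSpace ℝ (Fin d)) := by subst hd0; infer_instance
    have hprob' := hprob (k + 1)
    have heq : (uhmcKernel f T h)^[k + 1] μ = ν := by
      ext s -
      rcases s.eq_empty_or_nonempty with rfl | hs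
      · simp
      · rw [Subsingleton.eq_univ_of_nonempty hs, measure_univ, measure_univ]
    rw [heq, renyiDiv_self]
    exact EReal.coe_ennreal_nonneg _
  have hq1 : 0 < q - 1 := by linarith
  have hM := hf.nonneg_third
  have hc₁ : 0 < c₁ := by linarith [hmix.one_le]
  have hc₂ := hmix.pos
  have hd' : (0 : ℝ) < d := by exact_mod_cast hd
  have hδ₁0 : 0 < δ₁ := by rw [hδ₁]; positivity
  have hδ₂0 : 0 < δ₂ := by rw [hδ₂]; positivity
  have hlog2 : 0 < Real.log 2 := Real.log_pos one_lt_two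
  set s := √(Real.log 2) with hs
  have hs0 : 0 < s := Real.sqrt_pos.2 hlog2
  have hs2 : s ^ 2 = Real.log 2 := Real.sq_sqrt hlog2.le
  have hs1 : s ≤ 1 := by
    exact Real.sqrt_le_iff.2 ⟨zero_le_one, by linarith [Real.log_two_lt_d9]⟩
  set D := δ₁ + √(δ₁ ^ 2 + 16 * Real.log 2 * δ₂) with hD
  have hD0 : 0 < D := by positivity
  rcases eq_or_ne (orliczWasserstein expSqOrlicz μ ν) ∞ with htop | htop
  · have hpos : ENNReal.ofReal
        ((δ₁ + δ₂) / (q - 1) * s * c₁ ^ 2 * Real.exp (-c₂ * k)) ≠ 0 := by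
      simp only [ne_eq, ENNReal.ofReal_eq_zero, not_le]
      positivity
    rw [htop, ENNReal.top_pow two_ne_zero, max_eq_right le_top, ENNReal.mul_top hpos]
    exact le_top
  set w₀ := (orliczWasserstein expSqOrlicz μ ν).toReal with hw₀
  have hw₀0 : 0 ≤ w₀ := ENNReal.toReal_nonneg
  have hW : orliczWasserstein expSqOrlicz μ ν = ENNReal.ofReal w₀ := (ENNReal.ofReal_toReal htop).symm
  rw [hW] at hk ⊢
  set w := c₁ * Real.exp (-c₂ * k) * w₀ with hw
  have hw0 : 0 ≤ w := by positivity
  have hWk : orliczWasserstein expSqOrlicz ((uhmcKernel f T h)^[k] μ) ν ≤ ENNReal.ofReal w := by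
    rw [hw, ENNReal.ofReal_mul (by positivity), ← hW]
    rcases Nat.eq_zero_or_pos k with rfl | hkpos
    · -- the contraction hypothesis starts at `k = 1`; for `k = 0` the bound is `1 ≤ c₁`
      simp only [Function.iterate_zero, id, Nat.cast_zero, mul_zero, Real.exp_zero, mul_one]
      exact le_mul_of_one_le_left zero_le (ENNReal.one_le_ofReal.2 hmix.one_le)
    · exact hmix.contraction μ inferInstance k hkpos
  have hθ : δ₁ * w / (2 * s) + δ₂ * w ^ 2 ≤ 1 := by
    refine quadratic_le_one_of_mul_le hs0 hδ₁0 hδ₂0 hw0 ?_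
    rw [hs2]
    exact mul_exp_le_of_log_le hc₁ hc₂ (by positivity) hD0 hw₀0 hk
  have := hprob k
  obtain ⟨hac, hint⟩ := lintegral_rnDeriv_uhmcKernel_le_of_quadratic_le hf hd hT hh hdvd hLT' hq
    hmix.stationary hδ₁0 hδ₁ hδ₂ hw0 hWk hθ
  have hmax : max 1 (ENNReal.ofReal w₀ ^ 2) = ENNReal.ofReal (max 1 (w₀ ^ 2)) := by
    rw [ENNReal.ofReal_max, ENNReal.ofReal_one, ENNReal.ofReal_pow hw₀0]
  rw [Function.iterate_succ_apply', hmax, ← ENNReal.ofReal_mul (by positivity),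
    EReal.coe_ennreal_ofReal, max_eq_left (by positivity)]
  refine renyiDiv_le_of_lintegral_le hq hac hint ?_
  set m := max 1 (w₀ ^ 2) with hm
  set E := Real.exp (-c₂ * k) with hE
  have hE0 : 0 < E := Real.exp_pos _
  have hE1 : E ≤ 1 := Real.exp_le_one_iff.2 (by
    have : 0 ≤ c₂ * k := by positivity
    linarith)
  have hm1 : 1 ≤ m := le_max_left _ _
  have hw₀m : w₀ ≤ m := by
    rcases le_total w₀ 1 with h1 | h1
    · exact h1.trans hm1
    · exact (by nlinarith : w₀ ≤ w₀ ^ 2).trans (le_max_right _ _)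
  have hwle : w ≤ c₁ ^ 2 * E * m := by
    have h1 : c₁ ≤ c₁ ^ 2 := by nlinarith [hmix.one_le]
    rw [hw]
    gcongr
  have hw2le : w ^ 2 ≤ c₁ ^ 2 * E * m := by
    have h1 : E ^ 2 ≤ E := by nlinarith
    calc w ^ 2 = c₁ ^ 2 * E ^ 2 * w₀ ^ 2 := by rw [hw]; ring
      _ ≤ c₁ ^ 2 * E * m := by
        gcongr
        exact le_max_right _ _
  calc (q - 1)⁻¹ * (s * δ₁ * w + Real.log 2 * δ₂ * w ^ 2)
      ≤ (q - 1)⁻¹ * (s * δ₁ * (c₁ ^ 2 * E * m) + s * δ₂ * (c₁ ^ 2 * E * m)) := by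
        have h1 : Real.log 2 ≤ s := by rw [← hs2]; nlinarith
        gcongr
    _ = _ := by field_simp
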